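/- Let $1<p\le\infty$ and let $\alpha:(0,1]\to\mathbb R$ be a (Lebesgue) measurable function with $\inf_{\varepsilon\le t\le 1}\alpha(t)>0$ for every $0<\varepsilon\le 1$. For $f\in L_p[0,1]$ (real or complex) put $$(R^{\alpha(\cdot)}f)(t):=\frac1{\Gamma(\alpha(t))}\int_0^t (t-s)^{\alpha(t)-1}f(s)\,ds .$$ For every $f\in L_p[0,1]$ the integral converges absolutely for almost all $t\in[0,1]$, and $R^{\alpha(\cdot)}$ is a bounded linear operator from $L_p[0,1]$ to $L_p[0,1]$. Moreover: (i) if $\lim_{t\to0^+}t^{\alpha(t)}=0$, then $R^{\alpha(\cdot)}$ is a compact operator on $L_p[0,1]$; (ii) if $\liminf_{t\to0^+}t^{\alpha(t)}>0$, then $R^{\alpha(\cdot)}$ is not compact on $L_p[0,1]$. The hypothesis of (i) is equivalent to $\lim_{t\to0^+}\alpha(t)|\ln t|=\infty$, and the hypothesis of (ii) is equivalent to $\limsup_{t\to0^+}\alpha(t)|\ln t|<\infty$; so $R^{\alpha(\cdot)}$ is compact in the former case and non-compact in the latter. -/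

import Mathlib

open MeasureTheory Filter Topology
open scoped ENNReal

/-- The space `L_p[0,1]` (with respect to Lebesgue measure) of `𝕜`-valued functions,
where `𝕜` is `ℝ` or `ℂ`. -/
abbrev LpUnit (𝕜 : Type*) [RCLike 𝕜] (p : ℝ≥0∞) : Type _ :=
  Lp 𝕜 p (volume.restrict (Set.Icc (0 : ℝ) 1))

/-- The integrand `s ↦ (t - s) ^ (α(t) - 1) f(s)` of the fractional integral of variable order
`α(·)` at the point `t`. -/
noncomputable def rlIntegrand {𝕜 : Type*} [RCLike 𝕜] (α : ℝ → ℝ) (f : ℝ → 𝕜) (t s : ℝ) : 𝕜 :=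
  (t - s) ^ (α t - 1) • f s

/-- The Riemann–Liouville integral of variable order `α(·)`:
`(R^{α(·)} f)(t) = Γ(α(t))⁻¹ ∫₀ᵗ (t - s) ^ (α(t) - 1) f(s) ds`. -/
noncomputable def rlIntegral {𝕜 : Type*} [RCLike 𝕜] (α : ℝ → ℝ) (f : ℝ → 𝕜) (t : ℝ) : 𝕜 :=
  (1 / Real.Gamma (α t)) • ∫ s in (0 : ℝ)..t, rlIntegrand α f t s

/-- The bounded linear operator `T` on `L_p[0,1]` is the operator `R^{α(·)}`: for every
`f ∈ L_p[0,1]` and almost every `t ∈ [0,1]`, the integral defining `(R^{α(·)} f)(t)` converges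
absolutely and `(T f)(t) = (R^{α(·)} f)(t)`. There is at most one such `T`. -/
def IsRLOperator {𝕜 : Type*} [RCLike 𝕜] {p : ℝ≥0∞} [Fact (1 ≤ p)] (α : ℝ → ℝ)
    (T : LpUnit 𝕜 p →L[𝕜] LpUnit 𝕜 p) : Prop :=
  ∀ f : LpUnit 𝕜 p, ∀ᵐ t ∂(volume.restrict (Set.Icc (0 : ℝ) 1)),
    IntervalIntegrable (rlIntegrand α f t) volume 0 t ∧ T f t = rlIntegral α f t

/-! Boundedness rests on a pointwise domination by the Hardy–Littlewood maximal function `M f`. For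
a fixed order `a`, the kernel `(t - s) ^ (a - 1)` on `(t - d, t)` is compared with averages of `|f|`
over intervals ending at `t`, at a cost of order `d ^ a * max 1 (1 / a)`. Division by `Γ(a)` makes
the constant independent of `a`, because `a Γ(a) = Γ(a + 1)` is bounded below. Hence `|R f (t)| ≤ 2
C t ^ α(t) M f (t)`, finite almost everywhere, and the strong maximal inequality for `p > 1` gives
the operator bound.

For compactness the same domination measures errors. Near the origin the factor `t ^ α(t)` is small.
Away from it `α ≥ c > 0`, so smoothing the kernel within distance `δ` of the diagonal costs at most
`4 C δ ^ c M f (t)`. Very large orders are harmless since `1 / Γ` is small there. The remaining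
smoothed kernels depend continuously on parameters in a compact set, so finitely many functionals
describe them up to `η`. Thus `‖T f‖ ≤ ‖S f‖ + η' ‖f‖` with `S` of finite rank and `η'` arbitrary,
and `T` is compact.

For non-compactness, normalized indicators of `(0, h]` are tested as `h → 0`. If `α(t) |log t|` is
bounded, their images have norm at least some `m > 0`, because on `(0, h]` the operator multiplies
the indicator by `t ^ α(t) / Γ(α(t) + 1)`. The images nevertheless tend to zero at each `t > 0`, so
no subsequence converges in norm. -/

/-! ### The Hardy–Littlewood maximal inequality -/

/-- The centred Hardy–Littlewood maximal function on the real line. -/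
noncomputable def maximalFunction (g : ℝ → ℝ≥0∞) (t : ℝ) : ℝ≥0∞ :=
  ⨆ h : Set.Ioi (0 : ℝ), (∫⁻ s in Metric.closedBall t h, g s) / ENNReal.ofReal (2 * h)

theorem lintegral_closedBall_le_maximalFunction (g : ℝ → ℝ≥0∞) (t : ℝ) {h : ℝ} (hh : 0 < h) :
    ∫⁻ s in Metric.closedBall t h, g s ≤ ENNReal.ofReal (2 * h) * maximalFunction g t := by
  rw [mul_comm, ← ENNReal.div_le_iff_le_mul]
  · exact le_iSup (fun h : Set.Ioi (0 : ℝ) =>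
      (∫⁻ s in Metric.closedBall t h, g s) / ENNReal.ofReal (2 * h)) ⟨h, hh⟩
  · left; simpa using hh
  · left; exact ENNReal.ofReal_ne_top

theorem lt_maximalFunction_iff {g : ℝ → ℝ≥0∞} {t : ℝ} {l : ℝ≥0∞} :
    l < maximalFunction g t ↔
      ∃ h : ℝ, 0 < h ∧ l * ENNReal.ofReal (2 * h) < ∫⁻ s in Metric.closedBall t h, g s := by
  unfold maximalFunction
  rw [lt_iSup_iff]
  constructor
  · rintro ⟨⟨h, hh⟩, H⟩
    refine ⟨h, hh, ?_⟩
    rwa [ENNReal.lt_div_iff_mul_lt] at H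
    · left; simpa using hh
    · left; exact ENNReal.ofReal_ne_top
  · rintro ⟨h, hh, H⟩
    refine ⟨⟨h, hh⟩, ?_⟩
    rwa [ENNReal.lt_div_iff_mul_lt]
    · left; simpa using hh
    · left; exact ENNReal.ofReal_ne_top

/-- The weak type `(1, 1)` inequality for the maximal function. -/
theorem mul_volume_lt_maximalFunction_le (g : ℝ → ℝ≥0∞) (l : ℝ≥0∞) (hl : l ≠ 0) :
    l * volume {t | l < maximalFunction g t} ≤ 4 * ∫⁻ s, g s := by
  rcases eq_or_ne (∫⁻ s, g s) ∞ with hI | hI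
  · simp [hI]
  rcases eq_or_ne l ∞ with rfl | hl'
  · simp
  set E : Set ℝ := {t | l < maximalFunction g t} with hE
  have hex : ∀ t : ℝ, ∃ h : ℝ, t ∈ E →
      (0 < h ∧ l * ENNReal.ofReal (2 * h) < ∫⁻ s in Metric.closedBall t h, g s) := by
    intro t
    by_cases ht : t ∈ E
    · obtain ⟨h, h1⟩ := lt_maximalFunction_iff.1 ht
      exact ⟨h, fun _ => h1⟩
    · exact ⟨0, fun h => absurd h ht⟩
  choose r hr using hex
  have hbd : ∀ a ∈ E, r a ≤ ((∫⁻ s, g s) / l).toReal := by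
    intro a ha
    obtain ⟨h0, h1⟩ := hr a ha
    have h2 : ENNReal.ofReal (2 * r a) ≤ (∫⁻ s, g s) / l := by
      rw [ENNReal.le_div_iff_mul_le (Or.inl hl) (Or.inl hl'), mul_comm]
      exact h1.le.trans (setLIntegral_le_lintegral _ _)
    have h3 := (ENNReal.ofReal_le_iff_le_toReal (ENNReal.div_ne_top hI hl)).1 h2
    linarith
  -- The radii are bounded because `l * 2r` is at most the finite total integral. The enlargement
  -- factor 4 is the constant of the weak type bound.
  obtain ⟨u, huE, hdisj, hcov⟩ := Vitali.exists_disjoint_subfamily_covering_enlargement_closedBall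
    E (fun t => t) r _ hbd 4 (by norm_num)
  have hcount : u.Countable := by
    refine hdisj.countable_of_nonempty_interior fun a ha => ?_
    refine ⟨a, ?_⟩
    exact Metric.ball_subset_interior_closedBall (Metric.mem_ball_self (hr a (huE ha)).1)
  have hsub : E ⊆ ⋃ b ∈ u, Metric.closedBall b (4 * r b) := by
    intro a ha
    obtain ⟨b, hb, hab⟩ := hcov a ha
    exact Set.mem_biUnion hb (hab (Metric.mem_closedBall_self (hr a ha).1.le))
  have : Countable u := hcount.to_subtype
  calc l * volume E ≤ l * ∑' b : u, volume (Metric.closedBall (b : ℝ) (4 * r b)) := by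
        gcongr
        exact (measure_mono hsub).trans (measure_biUnion_le _ hcount _)
    _ = ∑' b : u, l * volume (Metric.closedBall (b : ℝ) (4 * r b)) := ENNReal.tsum_mul_left.symm
    _ ≤ ∑' b : u, 4 * ∫⁻ s in Metric.closedBall (b : ℝ) (r b), g s := by
        refine ENNReal.tsum_le_tsum fun b => ?_
        obtain ⟨h0, h1⟩ := hr b (huE b.2)
        rw [Real.volume_closedBall, show 2 * (4 * r b) = 4 * (2 * r b) by ring,
          ENNReal.ofReal_mul (by norm_num), mul_left_comm]
        simp only [ENNReal.ofReal_ofNat]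
        gcongr
    _ = 4 * ∑' b : u, ∫⁻ s in Metric.closedBall (b : ℝ) (r b), g s := ENNReal.tsum_mul_left
    _ = 4 * ∫⁻ s in ⋃ b ∈ u, Metric.closedBall b (r b), g s := by
        rw [lintegral_biUnion hcount (fun _ _ => measurableSet_closedBall) hdisj]
    _ ≤ 4 * ∫⁻ s, g s := by
        gcongr
        exact Measure.restrict_le_self

/-- The weak type bound at every level `n` gives `n * |E| ≤ 4 ∫ g < ∞` for the set `E` of infinite
values, which forces `|E| = 0`. -/
theorem ae_maximalFunction_lt_top {g : ℝ → ℝ≥0∞} (hg : ∫⁻ s, g s ≠ ∞) :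
    ∀ᵐ t, maximalFunction g t < ∞ := by
  rw [ae_iff]
  by_contra H
  set E : Set ℝ := {t | ¬ maximalFunction g t < ∞}
  have key : ∀ n : ℕ, n ≠ 0 → (n : ℝ≥0∞) * volume E ≤ 4 * ∫⁻ s, g s := by
    intro n hn
    refine le_trans ?_ (mul_volume_lt_maximalFunction_le g n (by simpa using hn))
    gcongr
    intro t ht
    have : maximalFunction g t = ∞ := by simpa [E] using ht
    simp [this]
  have h4 : 4 * ∫⁻ s, g s ≠ ∞ := ENNReal.mul_ne_top (by simp) hg
  obtain ⟨n, hn⟩ := ENNReal.exists_nat_mul_gt H h4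
  have hn0 : n ≠ 0 := by
    rintro rfl
    simp at hn
  exact absurd (key n hn0) (not_le.2 hn)

/-- The set where the maximal function is large only sees the large values of the function. -/
theorem volume_lt_maximalFunction_le {g : ℝ → ℝ≥0∞} (hg : Measurable g) {l : ℝ} (hl : 0 < l) :
    volume {t | ENNReal.ofReal l < maximalFunction g t} ≤
      ENNReal.ofReal (8 / l) * ∫⁻ s in {s | ENNReal.ofReal (l / 2) < g s}, g s := by
  set A : Set ℝ := {s | ENNReal.ofReal (l / 2) < g s} with hA
  have hAm : MeasurableSet A := measurableSet_lt measurable_const hg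
  have hsub : {t | ENNReal.ofReal l < maximalFunction g t} ⊆
      {t | ENNReal.ofReal (l / 2) < maximalFunction (A.indicator g) t} := by
    intro t ht
    obtain ⟨h, hh, H⟩ := lt_maximalFunction_iff.1 ht
    refine lt_maximalFunction_iff.2 ⟨h, hh, ?_⟩
    -- Off `A` the function is at most `l / 2`, so this part contributes at most half the level to
    -- any average; the other half must come from `A.indicator g`. The weak type bound at level `l /
    -- 2` then gives `4 * (2 / l) = 8 / l`.
    have h1 : ∫⁻ s in Metric.closedBall t h, g s ≤
        (∫⁻ s in Metric.closedBall t h, A.indicator g s) +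
          ENNReal.ofReal (l / 2) * ENNReal.ofReal (2 * h) := by
      calc ∫⁻ s in Metric.closedBall t h, g s
          ≤ ∫⁻ s in Metric.closedBall t h, (A.indicator g s + ENNReal.ofReal (l / 2)) := by
            refine lintegral_mono fun s => ?_
            by_cases hs : s ∈ A
            · simp [hs]
            · simpa [hs] using not_lt.1 hs
        _ = _ := by
            rw [lintegral_add_right _ measurable_const, setLIntegral_const, Real.volume_closedBall]
    have h2 : ENNReal.ofReal l = ENNReal.ofReal (l / 2) + ENNReal.ofReal (l / 2) := by
      rw [← ENNReal.ofReal_add (by positivity) (by positivity)]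
      congr 1; ring
    rw [h2, add_mul] at H
    exact lt_of_add_lt_add_right (H.trans_le h1)
  have hw := mul_volume_lt_maximalFunction_le (A.indicator g) (ENNReal.ofReal (l / 2))
    (by simpa using hl)
  rw [lintegral_indicator hAm] at hw
  calc volume {t | ENNReal.ofReal l < maximalFunction g t}
      ≤ volume {t | ENNReal.ofReal (l / 2) < maximalFunction (A.indicator g) t} :=
        measure_mono hsub
    _ = ENNReal.ofReal (2 / l) * (ENNReal.ofReal (l / 2) *
          volume {t | ENNReal.ofReal (l / 2) < maximalFunction (A.indicator g) t}) := by
        rw [← mul_assoc, ← ENNReal.ofReal_mul (by positivity)]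
        have : 2 / l * (l / 2) = 1 := by field_simp
        simp [this]
    _ ≤ ENNReal.ofReal (2 / l) * (4 * ∫⁻ s in A, g s) := by gcongr
    _ = ENNReal.ofReal (8 / l) * ∫⁻ s in A, g s := by
        rw [← mul_assoc]
        congr 1
        rw [show (4 : ℝ≥0∞) = ENNReal.ofReal 4 by simp, ← ENNReal.ofReal_mul (by positivity)]
        congr 1; ring

/-- The inner integral left by Tonelli in the strong type estimate. The condition `p > 1` is what
makes `l ^ (p - 2)` integrable at zero. -/
theorem lintegral_Ioi_rpow_sub_two_indicator {p x : ℝ} (hp : 1 < p) (hx : 0 ≤ x) :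
    ∫⁻ l in Set.Ioi (0 : ℝ), {l | l < 2 * x}.indicator (fun l => ENNReal.ofReal (l ^ (p - 2))) l =
      ENNReal.ofReal ((2 * x) ^ (p - 1) / (p - 1)) := by
  have hm : MeasurableSet {l : ℝ | l < 2 * x} := measurableSet_Iio
  rw [lintegral_indicator hm, Measure.restrict_restrict hm]
  have hs : {l : ℝ | l < 2 * x} ∩ Set.Ioi 0 = Set.Ioo 0 (2 * x) := by
    ext l; simp [and_comm]
  have hint : IntervalIntegrable (fun l : ℝ => l ^ (p - 2)) volume 0 (2 * x) :=
    intervalIntegral.intervalIntegrable_rpow' (by linarith)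
  rw [hs, Measure.restrict_congr_set Ioo_ae_eq_Ioc, ← ofReal_integral_eq_lintegral_ofReal,
    ← intervalIntegral.integral_of_le (by positivity), integral_rpow (Or.inl (by linarith))]
  · have h1 : p - 2 + 1 = p - 1 := by ring
    rw [h1, Real.zero_rpow (by linarith), sub_zero]
  · exact (intervalIntegrable_iff_integrableOn_Ioc_of_le (by positivity)).1 hint
  · filter_upwards [ae_restrict_mem measurableSet_Ioc] with l hl
    exact Real.rpow_nonneg hl.1.le _

/-- The strong type `(p, p)` inequality for functions dominated by a maximal function. -/
theorem lintegral_rpow_le_of_le_maximalFunction {p : ℝ} (hp : 1 < p) {f : ℝ → ℝ}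
    (hf : Measurable f) (hf0 : ∀ s, 0 ≤ f s) {μ : Measure ℝ} (hμ : μ ≤ volume) {u : ℝ → ℝ}
    (hu : AEMeasurable u μ) (hu0 : ∀ t, 0 ≤ u t)
    (hum : ∀ᵐ t ∂μ, ENNReal.ofReal (u t) ≤ maximalFunction (fun s => ENNReal.ofReal (f s)) t) :
    ∫⁻ t, ENNReal.ofReal (u t ^ p) ∂μ ≤
      ENNReal.ofReal (p * 8 * (2 ^ (p - 1) / (p - 1))) * ∫⁻ s, ENNReal.ofReal (f s ^ p) := by
  rw [lintegral_rpow_eq_lintegral_meas_lt_mul μ (ae_of_all _ hu0) hu (by linarith)]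
  -- The bound for each level is written as an integral over `s`, so that exchanging `l` and `s`
  -- leaves `f` times an integral of size `f ^ (p - 1)`.
  have hlevel : ∀ l ∈ Set.Ioi (0 : ℝ), μ {a | l < u a} * ENNReal.ofReal (l ^ (p - 1)) ≤
      ∫⁻ s, 8 * ENNReal.ofReal (f s) *
        {l : ℝ | l < 2 * f s}.indicator (fun l => ENNReal.ofReal (l ^ (p - 2))) l := by
    intro l hl
    have hl0 : 0 < l := hl
    have h1 : μ {a | l < u a} ≤ ENNReal.ofReal (8 / l) *
        ∫⁻ s in {s | ENNReal.ofReal (l / 2) < ENNReal.ofReal (f s)}, ENNReal.ofReal (f s) := by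
      refine le_trans ?_ (volume_lt_maximalFunction_le hf.ennreal_ofReal hl0)
      refine le_trans (measure_mono_ae ?_) (hμ _)
      filter_upwards [hum] with t ht hlt
      exact lt_of_lt_of_le ((ENNReal.ofReal_lt_ofReal_iff_of_nonneg hl0.le).2 hlt) ht
    have hset : {s | ENNReal.ofReal (l / 2) < ENNReal.ofReal (f s)} = {s | l < 2 * f s} := by
      ext s
      simp only [Set.mem_ofPred_eq, ENNReal.ofReal_lt_ofReal_iff_of_nonneg (half_pos hl0).le]
      constructor <;> intro h <;> linarith
    have hm : MeasurableSet {s | l < 2 * f s} := measurableSet_lt measurable_const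
      (measurable_const.mul hf)
    rw [hset] at h1
    calc μ {a | l < u a} * ENNReal.ofReal (l ^ (p - 1))
        ≤ ENNReal.ofReal (8 / l) * (∫⁻ s in {s | l < 2 * f s}, ENNReal.ofReal (f s)) *
          ENNReal.ofReal (l ^ (p - 1)) := by gcongr
      _ = ENNReal.ofReal (8 * l ^ (p - 2)) *
          ∫⁻ s in {s | l < 2 * f s}, ENNReal.ofReal (f s) := by
          rw [mul_right_comm, ← ENNReal.ofReal_mul (by positivity)]
          congr 2
          have h2 : l ^ (p - 2) = l ^ (p - 1) / l := by
            rw [← Real.rpow_sub_one hl0.ne']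
            congr 1; ring
          rw [h2]
          ring
      _ = ∫⁻ s in {s | l < 2 * f s}, ENNReal.ofReal (8 * l ^ (p - 2)) * ENNReal.ofReal (f s) := by
          rw [lintegral_const_mul _ hf.ennreal_ofReal]
      _ = _ := by
          rw [← lintegral_indicator hm]
          refine lintegral_congr fun s => ?_
          by_cases hs : l < 2 * f s
          · simp only [Set.indicator, Set.mem_ofPred_eq, hs, if_true]
            rw [ENNReal.ofReal_mul (by norm_num)]
            simp only [ENNReal.ofReal_ofNat]
            ring
          · simp [Set.indicator, hs]
  have hmeas : Measurable (fun q : ℝ × ℝ => 8 * ENNReal.ofReal (f q.2) *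
      {l : ℝ | l < 2 * f q.2}.indicator (fun l => ENNReal.ofReal (l ^ (p - 2))) q.1) := by
    refine Measurable.mul (by fun_prop) ?_
    have : (fun q : ℝ × ℝ => {l : ℝ | l < 2 * f q.2}.indicator
        (fun l => ENNReal.ofReal (l ^ (p - 2))) q.1) = {q : ℝ × ℝ | q.1 < 2 * f q.2}.indicator
          (fun q => ENNReal.ofReal (q.1 ^ (p - 2))) := by
      ext q; simp [Set.indicator]
    rw [this]
    refine Measurable.indicator ?_ (measurableSet_lt measurable_fst (by fun_prop))
    exact (measurable_fst.pow_const _).ennreal_ofReal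
  calc ENNReal.ofReal p * ∫⁻ l in Set.Ioi 0, μ {a | l < u a} * ENNReal.ofReal (l ^ (p - 1))
      ≤ ENNReal.ofReal p * ∫⁻ l in Set.Ioi (0 : ℝ), ∫⁻ s, 8 * ENNReal.ofReal (f s) *
        {l : ℝ | l < 2 * f s}.indicator (fun l => ENNReal.ofReal (l ^ (p - 2))) l := by
        gcongr ENNReal.ofReal p * ?_
        exact setLIntegral_mono' measurableSet_Ioi hlevel
    _ = ENNReal.ofReal p * ∫⁻ s, ∫⁻ l in Set.Ioi (0 : ℝ), 8 * ENNReal.ofReal (f s) *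
        {l : ℝ | l < 2 * f s}.indicator (fun l => ENNReal.ofReal (l ^ (p - 2))) l := by
        rw [lintegral_lintegral_swap hmeas.aemeasurable]
    _ = ENNReal.ofReal p * ∫⁻ s, ENNReal.ofReal (8 * (2 ^ (p - 1) / (p - 1))) *
          ENNReal.ofReal (f s ^ p) := by
        congr 1
        refine lintegral_congr fun s => ?_
        have hm : Measurable (fun l : ℝ => {l : ℝ | l < 2 * f s}.indicator
            (fun l => ENNReal.ofReal (l ^ (p - 2))) l) :=
          Measurable.indicator (measurable_id.pow_const _).ennreal_ofReal measurableSet_Iio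
        rw [lintegral_const_mul _ hm, lintegral_Ioi_rpow_sub_two_indicator hp (hf0 s),
          show (8 : ℝ≥0∞) = ENNReal.ofReal 8 by simp, ← ENNReal.ofReal_mul (by norm_num),
          ← ENNReal.ofReal_mul (by have := hf0 s; positivity),
          ← ENNReal.ofReal_mul (by have : 0 < p - 1 := by linarith
                                   positivity)]
        congr 1
        rw [Real.mul_rpow (by norm_num) (hf0 s)]
        have h2 : f s ^ p = f s * f s ^ (p - 1) := by
          rw [← Real.rpow_one_add' (hf0 s) (by linarith)]
          congr 1; ring
        rw [h2]
        ring
    _ = _ := by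
        rw [lintegral_const_mul _ (hf.pow_const _).ennreal_ofReal, ← mul_assoc,
          ← ENNReal.ofReal_mul (by linarith), mul_assoc p]

theorem maximalFunction_le_of_ae_le {g : ℝ → ℝ≥0∞} {b : ℝ≥0∞} (h : ∀ᵐ s, g s ≤ b) (t : ℝ) :
    maximalFunction g t ≤ b := by
  refine iSup_le fun ⟨r, hr⟩ => ?_
  refine ENNReal.div_le_of_le_mul ?_
  calc ∫⁻ s in Metric.closedBall t r, g s ≤ ∫⁻ s in Metric.closedBall t r, b :=
        lintegral_mono_ae (ae_restrict_of_ae h)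
    _ = b * ENNReal.ofReal (2 * r) := by rw [setLIntegral_const, Real.volume_closedBall]

/-- The strong type `(p, p)` inequality, `1 < p ≤ ∞`, for functions dominated by a maximal
function. -/
theorem exists_eLpNorm_le_of_le_maximalFunction {p : ℝ≥0∞} (hp : 1 < p) :
    ∃ K : ℝ, 0 < K ∧ ∀ (f : ℝ → ℝ), Measurable f → (∀ s, 0 ≤ f s) →
      ∀ (μ : Measure ℝ), μ ≤ volume → ∀ u : ℝ → ℝ, AEMeasurable u μ → (∀ t, 0 ≤ u t) →
      (∀ᵐ t ∂μ, ENNReal.ofReal (u t) ≤ maximalFunction (fun s => ENNReal.ofReal (f s)) t) →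
      eLpNorm u p μ ≤ ENNReal.ofReal K * eLpNorm f p volume := by
  rcases eq_or_ne p ∞ with rfl | hp'
  · refine ⟨1, one_pos, fun f hf hf0 μ hμ u hu hu0 hum => ?_⟩
    rw [ENNReal.ofReal_one, one_mul, eLpNorm_exponent_top, eLpNorm_exponent_top]
    refine essSup_le_of_ae_le _ ?_
    filter_upwards [hum] with t ht
    rw [← ofReal_norm, Real.norm_of_nonneg (hu0 t)]
    refine ht.trans (maximalFunction_le_of_ae_le ?_ t)
    filter_upwards [enorm_ae_le_eLpNormEssSup f volume] with s hs
    rwa [← ofReal_norm, Real.norm_of_nonneg (hf0 s)] at hs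
  · have hp1 : 1 < p.toReal := by
      have := (ENNReal.toReal_lt_toReal ENNReal.one_ne_top hp').2 hp
      simpa using this
    set q := p.toReal with hq
    have hp0 : p ≠ 0 := (zero_lt_one.trans hp).ne'
    have hq0 : 0 < q := by linarith
    have hq1 : 0 < q - 1 := by linarith
    refine ⟨(q * 8 * (2 ^ (q - 1) / (q - 1))) ^ (1 / q), by positivity,
      fun f hf hf0 μ hμ u hu hu0 hum => ?_⟩
    have key := lintegral_rpow_le_of_le_maximalFunction hp1 hf hf0 hμ hu hu0 hum
    rw [eLpNorm_eq_lintegral_rpow_enorm_toReal hp0 hp',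
      eLpNorm_eq_lintegral_rpow_enorm_toReal hp0 hp', ← hq,
      ← ENNReal.ofReal_rpow_of_pos (by positivity),
      ← ENNReal.mul_rpow_of_nonneg _ _ (by positivity)]
    have conv : ∀ x : ℝ, 0 ≤ x → ‖x‖ₑ ^ q = ENNReal.ofReal (x ^ q) := by
      intro x hx
      rw [← ofReal_norm, Real.norm_of_nonneg hx, ENNReal.ofReal_rpow_of_nonneg hx hq0.le]
    simp only [conv _ (hu0 _), conv _ (hf0 _)]
    gcongr

/-- The modulus of `f` on `[0,1]`, extended by zero. -/
noncomputable def unitENorm {𝕜 : Type*} [RCLike 𝕜] (f : ℝ → 𝕜) : ℝ → ℝ≥0∞ :=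
  (Set.Icc (0 : ℝ) 1).indicator fun s => ‖f s‖ₑ

theorem measurable_unitENorm {𝕜 : Type*} [RCLike 𝕜] {f : ℝ → 𝕜} (hf : StronglyMeasurable f) :
    Measurable (unitENorm f) :=
  hf.enorm.indicator measurableSet_Icc

theorem unitENorm_of_mem {𝕜 : Type*} [RCLike 𝕜] {f : ℝ → 𝕜} {s : ℝ} (hs : s ∈ Set.Icc (0 : ℝ) 1) :
    unitENorm f s = ‖f s‖ₑ := by simp [unitENorm, hs]

theorem lintegral_unitENorm {𝕜 : Type*} [RCLike 𝕜] (f : ℝ → 𝕜) :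
    ∫⁻ s, unitENorm f s = eLpNorm f 1 (volume.restrict (Set.Icc (0 : ℝ) 1)) := by
  rw [eLpNorm_one_eq_lintegral_enorm, ← lintegral_indicator measurableSet_Icc]
  rfl

/-- `K` is chosen before `f`, `u` and `c`, and `c` enters linearly: a small pointwise factor yields
a small norm. -/
theorem exists_eLpNorm_le_of_le_mul_maximalFunction (𝕜 : Type*) [RCLike 𝕜] {p : ℝ≥0∞}
    (hp : 1 < p) :
    ∃ K : ℝ, 0 < K ∧ ∀ (f : ℝ → 𝕜), StronglyMeasurable f →
      ∀ u : ℝ → ℝ, AEMeasurable u (volume.restrict (Set.Icc (0 : ℝ) 1)) → (∀ t, 0 ≤ u t) →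
      ∀ c : ℝ, 0 < c →
      (∀ᵐ t ∂(volume.restrict (Set.Icc (0 : ℝ) 1)),
        ENNReal.ofReal (u t) ≤ ENNReal.ofReal c * maximalFunction (unitENorm f) t) →
      eLpNorm u p (volume.restrict (Set.Icc (0 : ℝ) 1)) ≤
        ENNReal.ofReal (c * K) * eLpNorm f p (volume.restrict (Set.Icc (0 : ℝ) 1)) := by
  obtain ⟨K, hK, H⟩ := exists_eLpNorm_le_of_le_maximalFunction hp
  refine ⟨K, hK, fun f hf u hu hu0 c hc hum => ?_⟩
  set F : ℝ → ℝ := (Set.Icc (0 : ℝ) 1).indicator fun s => ‖f s‖ with hF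
  have hF0 : ∀ s, 0 ≤ F s := fun s => Set.indicator_nonneg (fun _ _ => norm_nonneg _) s
  have hFe : (fun s => ENNReal.ofReal (F s)) = unitENorm f := by
    ext s
    by_cases hs : s ∈ Set.Icc (0 : ℝ) 1
    · simp only [hF, unitENorm, Set.indicator_of_mem hs, ofReal_norm]
    · simp only [hF, unitENorm, Set.indicator_of_notMem hs, ENNReal.ofReal_zero]
  have h1 := H F (hf.norm.measurable.indicator measurableSet_Icc) hF0
    (volume.restrict (Set.Icc (0 : ℝ) 1)) Measure.restrict_le_self (fun t => c⁻¹ * u t)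
    (hu.const_mul _) (fun t => mul_nonneg (inv_nonneg.2 hc.le) (hu0 t)) (by
      rw [hFe]
      filter_upwards [hum] with t ht
      rw [ENNReal.ofReal_mul (by positivity)]
      calc _ ≤ ENNReal.ofReal c⁻¹ * (ENNReal.ofReal c * maximalFunction (unitENorm f) t) := by
            gcongr
        _ = _ := by
            rw [← mul_assoc, ← ENNReal.ofReal_mul (by positivity), inv_mul_cancel₀ hc.ne']
            simp)
  have h2 : eLpNorm F p volume = eLpNorm f p (volume.restrict (Set.Icc (0 : ℝ) 1)) := by
    rw [hF, eLpNorm_indicator_eq_eLpNorm_restrict measurableSet_Icc, eLpNorm_norm]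
  have h3 : u = c • fun t => c⁻¹ * u t := by
    ext t
    simp [mul_inv_cancel_left₀ hc.ne']
  rw [h2] at h1
  rw [h3, eLpNorm_const_smul, ENNReal.ofReal_mul hc.le, mul_assoc, ← ofReal_norm,
    Real.norm_of_nonneg hc.le]
  gcongr

/-! ### The Gamma function -/

/-- `Γ` attains a positive minimum on `[1, 2]` and increases on `[2, ∞)`. -/
theorem exists_pos_le_Gamma : ∃ c : ℝ, 0 < c ∧ ∀ x : ℝ, 1 ≤ x → c ≤ Real.Gamma x := by
  have hcont : ContinuousOn Real.Gamma (Set.Icc 1 2) := fun x hx =>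
    (Real.differentiableAt_Gamma fun m => by
      have : (0 : ℝ) ≤ m := m.cast_nonneg
      linarith [hx.1]).continuousAt.continuousWithinAt
  obtain ⟨x, hx, hmin⟩ := isCompact_Icc.exists_isMinOn (Set.nonempty_Icc.2 one_le_two) hcont
  refine ⟨Real.Gamma x, Real.Gamma_pos_of_pos (by linarith [hx.1]), fun y hy => ?_⟩
  rcases le_total y 2 with h | h
  · exact hmin ⟨hy, h⟩
  · exact (hmin (⟨one_le_two, le_rfl⟩ : (2 : ℝ) ∈ Set.Icc 1 2)).trans
      (Real.Gamma_strictMonoOn_Ici.monotoneOn (by simp) h h)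

/-- Makes all later bounds uniform in the order, even as it approaches zero: the loss `1 / a` from
integrating the singularity is absorbed by `a Γ(a) = Γ(a + 1)`. -/
theorem exists_inv_Gamma_mul_max_le :
    ∃ C : ℝ, 0 < C ∧ ∀ a : ℝ, 0 < a → 1 / Real.Gamma a * max 1 (1 / a) ≤ C := by
  obtain ⟨c, hc, H⟩ := exists_pos_le_Gamma
  refine ⟨1 / c, by positivity, fun a ha => ?_⟩
  have hG := Real.Gamma_pos_of_pos ha
  rcases le_total 1 a with h | h
  · rw [max_eq_left ((div_le_one ha).2 h), mul_one]
    exact one_div_le_one_div_of_le hc (H a h)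
  · rw [max_eq_right ((one_le_div ha).2 h), one_div_mul_one_div, mul_comm,
      ← Real.Gamma_add_one ha.ne']
    exact one_div_le_one_div_of_le hc (H _ (by linarith))

/-- By the functional equation `Γ(a) ≥ c (a - 1)` for `a ≥ 2`, with `c` the lower bound of `Γ` on
`[1, ∞)`. -/
theorem exists_inv_Gamma_le_of_le {η : ℝ} (hη : 0 < η) :
    ∃ A : ℝ, 1 ≤ A ∧ ∀ a : ℝ, A ≤ a → 1 / Real.Gamma a ≤ η := by
  obtain ⟨c, hc, H⟩ := exists_pos_le_Gamma
  refine ⟨2 + 1 / (c * η), by have : 0 < 1 / (c * η) := by positivity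
                              linarith, fun a ha => ?_⟩
  have h0 : 0 < 1 / (c * η) := by positivity
  have h1 : Real.Gamma a = (a - 1) * Real.Gamma (a - 1) := by
    rw [← Real.Gamma_add_one (by linarith)]
    congr 1; ring
  have h2 : 1 / η ≤ Real.Gamma a := by
    rw [h1]
    calc 1 / η = 1 / (c * η) * c := by field_simp
      _ ≤ (a - 1) * Real.Gamma (a - 1) := by
        gcongr
        · linarith
        · linarith
        · exact H _ (by linarith)
  calc 1 / Real.Gamma a ≤ 1 / (1 / η) := one_div_le_one_div_of_le (by positivity) h2
    _ = η := by simp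

/-- The reciprocal of `Γ` is entire, so the poles need no separate treatment. -/
theorem measurable_one_div_Gamma : Measurable fun x : ℝ => 1 / Real.Gamma x := by
  have h : (fun x : ℝ => 1 / Real.Gamma x) = fun x : ℝ => ((Complex.Gamma (x : ℂ))⁻¹).re := by
    ext x
    rw [Complex.Gamma_ofReal, ← Complex.ofReal_inv, Complex.ofReal_re, one_div]
  rw [h]
  exact (Complex.continuous_re.comp
    (Complex.differentiable_one_div_Gamma.continuous.comp Complex.continuous_ofReal)).measurable

/-! ### Bounds for the kernel -/

theorem lintegral_Ioo_le_maximalFunction (g : ℝ → ℝ≥0∞) (t : ℝ) {d : ℝ} (hd : 0 < d) :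
    ∫⁻ s in Set.Ioo (t - d) t, g s ≤ ENNReal.ofReal (2 * d) * maximalFunction g t := by
  refine le_trans (lintegral_mono_set ?_) (lintegral_closedBall_le_maximalFunction g t hd)
  rw [Real.closedBall_eq_Icc]
  intro s hs
  exact ⟨hs.1.le, by linarith [hs.2]⟩

theorem lintegral_Ioo_rpow {a d : ℝ} (ha : 0 < a) (hd : 0 < d) (t : ℝ) :
    ∫⁻ s in Set.Ioo (t - d) t, ENNReal.ofReal ((t - s) ^ (a - 1)) =
      ENNReal.ofReal (d ^ a / a) := by
  have h0 : IntervalIntegrable (fun r : ℝ => r ^ (a - 1)) volume d 0 :=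
    intervalIntegral.intervalIntegrable_rpow' (by linarith)
  have hint : IntervalIntegrable (fun s : ℝ => (t - s) ^ (a - 1)) volume (t - d) t := by
    simpa using h0.comp_sub_left t
  rw [Measure.restrict_congr_set Ioo_ae_eq_Ioc, ← ofReal_integral_eq_lintegral_ofReal,
    ← intervalIntegral.integral_of_le (by linarith),
    intervalIntegral.integral_comp_sub_left (fun r : ℝ => r ^ (a - 1)), sub_self, sub_sub_cancel,
    integral_rpow (Or.inl (by linarith))]
  · rw [sub_add_cancel, Real.zero_rpow ha.ne', sub_zero]
  · exact (intervalIntegrable_iff_integrableOn_Ioc_of_le (by linarith)).1 hint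
  · filter_upwards [ae_restrict_mem measurableSet_Ioc] with l hl
    exact Real.rpow_nonneg (by linarith [hl.2]) _

/-- The kernel `(t - s) ^ (a - 1)` is controlled by the maximal function. -/
theorem lintegral_Ioo_rpow_mul_le {g : ℝ → ℝ≥0∞} (hg : Measurable g) {a d : ℝ} (ha : 0 < a)
    (hd : 0 < d) (t : ℝ) :
    ∫⁻ s in Set.Ioo (t - d) t, ENNReal.ofReal ((t - s) ^ (a - 1)) * g s ≤
      ENNReal.ofReal (2 * d ^ a * max 1 (1 / a)) * maximalFunction g t := by
  rcases le_or_gt 1 a with h1 | h1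
  · rw [max_eq_left ((div_le_one ha).2 h1), mul_one]
    calc ∫⁻ s in Set.Ioo (t - d) t, ENNReal.ofReal ((t - s) ^ (a - 1)) * g s
        ≤ ∫⁻ s in Set.Ioo (t - d) t, ENNReal.ofReal (d ^ (a - 1)) * g s := by
          refine setLIntegral_mono' measurableSet_Ioo fun s hs => ?_
          gcongr
          · linarith [hs.2]
          · linarith [hs.1]
      _ = ENNReal.ofReal (d ^ (a - 1)) * ∫⁻ s in Set.Ioo (t - d) t, g s :=
          lintegral_const_mul _ hg
      _ ≤ ENNReal.ofReal (d ^ (a - 1)) * (ENNReal.ofReal (2 * d) * maximalFunction g t) := by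
          gcongr
          exact lintegral_Ioo_le_maximalFunction g t hd
      _ = _ := by
          rw [← mul_assoc, ← ENNReal.ofReal_mul (by positivity), Real.rpow_sub_one hd.ne']
          congr 2
          field_simp
  · rw [max_eq_right ((one_le_div ha).2 h1.le)]
    have hmk : Measurable fun s : ℝ => (t - s) ^ (a - 1) :=
      (measurable_const.sub measurable_id).pow_const _
    have hlayer : ∀ ν : Measure ℝ, ∫⁻ s, ENNReal.ofReal ((t - s) ^ (a - 1)) ∂(ν.restrict
        (Set.Ioo (t - d) t)) = ∫⁻ l in Set.Ioi (0 : ℝ),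
          ν.restrict (Set.Ioo (t - d) t) {s | l < (t - s) ^ (a - 1)} := by
      intro ν
      refine lintegral_eq_lintegral_meas_lt _ ?_ hmk.aemeasurable
      filter_upwards [ae_restrict_mem measurableSet_Ioo] with s hs
      exact Real.rpow_nonneg (by linarith [hs.2]) _
    -- For `a < 1` the kernel increases towards the diagonal, so its superlevel sets are intervals
    -- ending at `t`, whose `g`-mass the maximal function controls.
    have hset : ∀ l : ℝ, 0 < l → ∃ e : ℝ, 0 < e ∧
        {s | l < (t - s) ^ (a - 1)} ∩ Set.Ioo (t - d) t = Set.Ioo (t - e) t := by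
      intro l hl
      refine ⟨min d (l ^ (a - 1)⁻¹), lt_min hd (Real.rpow_pos_of_pos hl _), ?_⟩
      ext s
      simp only [Set.mem_inter_iff, Set.mem_ofPred_eq, Set.mem_Ioo]
      constructor
      · rintro ⟨h2, h3, h4⟩
        refine ⟨?_, h4⟩
        have h5 := (Real.lt_rpow_inv_iff_of_neg (show 0 < t - s by linarith) hl
          (by linarith : a - 1 < 0)).2 h2
        have : t - s < min d (l ^ (a - 1)⁻¹) := lt_min (by linarith) h5
        linarith
      · rintro ⟨h2, h4⟩
        have h5 : t - s < min d (l ^ (a - 1)⁻¹) := by linarith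
        obtain ⟨h6, h7⟩ := lt_min_iff.1 h5
        exact ⟨(Real.lt_rpow_inv_iff_of_neg (show 0 < t - s by linarith) hl
          (by linarith : a - 1 < 0)).1 h7, by linarith, h4⟩
    -- Layer-cake formulas for the measures `g ds` and `ds` are compared level by level.
    calc ∫⁻ s in Set.Ioo (t - d) t, ENNReal.ofReal ((t - s) ^ (a - 1)) * g s
        = ∫⁻ s, ENNReal.ofReal ((t - s) ^ (a - 1)) ∂((volume.withDensity g).restrict
            (Set.Ioo (t - d) t)) := by
          rw [restrict_withDensity measurableSet_Ioo,
            lintegral_withDensity_eq_lintegral_mul _ hg hmk.ennreal_ofReal]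
          simp only [Pi.mul_apply, mul_comm]
      _ = ∫⁻ l in Set.Ioi (0 : ℝ), (volume.withDensity g).restrict (Set.Ioo (t - d) t)
            {s | l < (t - s) ^ (a - 1)} := hlayer _
      _ ≤ ∫⁻ l in Set.Ioi (0 : ℝ), volume.restrict (Set.Ioo (t - d) t)
            {s | l < (t - s) ^ (a - 1)} * (2 * maximalFunction g t) := by
          refine setLIntegral_mono' measurableSet_Ioi fun l hl => ?_
          obtain ⟨e, he, hse⟩ := hset l hl
          rw [Measure.restrict_apply' measurableSet_Ioo, Measure.restrict_apply' measurableSet_Ioo,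
            hse, withDensity_apply _ measurableSet_Ioo, Real.volume_Ioo, sub_sub_cancel]
          refine (lintegral_Ioo_le_maximalFunction g t he).trans (le_of_eq ?_)
          rw [ENNReal.ofReal_mul (by norm_num), ENNReal.ofReal_ofNat]
          ring
      _ = (∫⁻ s in Set.Ioo (t - d) t, ENNReal.ofReal ((t - s) ^ (a - 1))) *
            (2 * maximalFunction g t) := by
          rw [lintegral_mul_const, hlayer]
          refine Antitone.measurable fun x y hxy => measure_mono fun s hs => ?_
          exact lt_of_le_of_lt hxy hs
      _ = _ := by
          rw [lintegral_Ioo_rpow ha hd, ← mul_assoc, show (2 : ℝ≥0∞) = ENNReal.ofReal 2 by simp,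
            ← ENNReal.ofReal_mul (by positivity)]
          congr 2
          ring

/-! ### The operator on `L_p[0,1]` and its boundedness -/

theorem restrict_Icc_eq_restrict_Ioc :
    (volume : Measure ℝ).restrict (Set.Icc (0 : ℝ) 1) = volume.restrict (Set.Ioc (0 : ℝ) 1) :=
  Measure.restrict_congr_set Ioc_ae_eq_Icc.symm

theorem ae_mem_Ioc_zero_one :
    ∀ᵐ t ∂((volume : Measure ℝ).restrict (Set.Icc (0 : ℝ) 1)), t ∈ Set.Ioc (0 : ℝ) 1 := by
  rw [restrict_Icc_eq_restrict_Ioc]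
  exact ae_restrict_mem measurableSet_Ioc

instance isProbabilityMeasure_restrict_Icc_zero_one :
    IsProbabilityMeasure ((volume : Measure ℝ).restrict (Set.Icc (0 : ℝ) 1)) :=
  ⟨by simp⟩

section

variable {𝕜 : Type*} [RCLike 𝕜] {α : ℝ → ℝ} {f g : ℝ → 𝕜}

theorem rlIntegrand_add (t s : ℝ) :
    rlIntegrand α (f + g) t s = rlIntegrand α f t s + rlIntegrand α g t s := by
  simp [rlIntegrand]

theorem rlIntegrand_smul (c : 𝕜) (t s : ℝ) :
    rlIntegrand α (c • f) t s = c • rlIntegrand α f t s := by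
  simp only [rlIntegrand, Pi.smul_apply]
  rw [smul_comm]

theorem stronglyMeasurable_rlIntegrand (hf : StronglyMeasurable f) (t : ℝ) :
    StronglyMeasurable (rlIntegrand α f t) :=
  ((measurable_const.sub measurable_id).pow_const _).stronglyMeasurable.smul hf

theorem enorm_rlIntegrand {t s : ℝ} (ht : t ≤ 1) (hs : s ∈ Set.Ioo 0 t) :
    ‖rlIntegrand α f t s‖ₑ = ENNReal.ofReal ((t - s) ^ (α t - 1)) * unitENorm f s := by
  rw [rlIntegrand, enorm_smul, unitENorm_of_mem ⟨hs.1.le, by linarith [hs.2]⟩,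
    Real.enorm_of_nonneg (Real.rpow_nonneg (by linarith [hs.2]) _)]

theorem lintegral_enorm_rlIntegrand_le (hf : StronglyMeasurable f) {t : ℝ}
    (ht : t ∈ Set.Ioc (0 : ℝ) 1) (ha : 0 < α t) :
    ∫⁻ s in Set.Ioc 0 t, ‖rlIntegrand α f t s‖ₑ ≤
      ENNReal.ofReal (2 * t ^ α t * max 1 (1 / α t)) * maximalFunction (unitENorm f) t := by
  have h := lintegral_Ioo_rpow_mul_le (measurable_unitENorm hf) ha ht.1 t
  rw [sub_self] at h
  rw [← Measure.restrict_congr_set Ioo_ae_eq_Ioc]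
  refine le_trans (le_of_eq ?_) h
  exact setLIntegral_congr_fun measurableSet_Ioo fun s hs => enorm_rlIntegrand ht.2 hs

theorem intervalIntegrable_rlIntegrand (hf : StronglyMeasurable f) {t : ℝ}
    (ht : t ∈ Set.Ioc (0 : ℝ) 1) (ha : 0 < α t) (hM : maximalFunction (unitENorm f) t < ∞) :
    IntervalIntegrable (rlIntegrand α f t) volume 0 t := by
  rw [intervalIntegrable_iff_integrableOn_Ioc_of_le ht.1.le]
  refine ⟨(stronglyMeasurable_rlIntegrand hf t).aestronglyMeasurable, ?_⟩
  exact (lintegral_enorm_rlIntegrand_le hf ht ha).trans_lt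
    (ENNReal.mul_lt_top ENNReal.ofReal_lt_top hM)

/-- The factor `t ^ α t` is kept: bounding it by 1 gives boundedness, and its smallness near the
origin gives compactness. -/
theorem enorm_rlIntegral_le (hf : StronglyMeasurable f) {C : ℝ}
    (hC : ∀ a : ℝ, 0 < a → 1 / Real.Gamma a * max 1 (1 / a) ≤ C) {t : ℝ}
    (ht : t ∈ Set.Ioc (0 : ℝ) 1) (ha : 0 < α t) :
    ‖rlIntegral α f t‖ₑ ≤
      ENNReal.ofReal (2 * C * t ^ α t) * maximalFunction (unitENorm f) t := by
  have hG := Real.Gamma_pos_of_pos ha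
  have htp : 0 < t ^ α t := Real.rpow_pos_of_pos ht.1 _
  rw [rlIntegral, enorm_smul, Real.enorm_of_nonneg (by positivity),
    intervalIntegral.integral_of_le ht.1.le]
  calc ENNReal.ofReal (1 / Real.Gamma (α t)) * ‖∫ s in Set.Ioc 0 t, rlIntegrand α f t s‖ₑ
      ≤ ENNReal.ofReal (1 / Real.Gamma (α t)) * (ENNReal.ofReal (2 * t ^ α t * max 1 (1 / α t)) *
          maximalFunction (unitENorm f) t) := by
        gcongr
        exact (enorm_integral_le_lintegral_enorm _).trans (lintegral_enorm_rlIntegrand_le hf ht ha)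
    _ ≤ _ := by
        rw [← mul_assoc, ← ENNReal.ofReal_mul (by positivity)]
        gcongr ENNReal.ofReal ?_ * _
        have h := mul_le_mul_of_nonneg_right (hC _ ha) (by positivity : 0 ≤ 2 * t ^ α t)
        linarith

theorem rlIntegral_congr (h : f =ᵐ[volume.restrict (Set.Icc (0 : ℝ) 1)] g) {t : ℝ}
    (ht : t ∈ Set.Icc (0 : ℝ) 1) : rlIntegral α f t = rlIntegral α g t := by
  have h' : ∀ᵐ s ∂(volume.restrict (Set.Ioc 0 t)), f s = g s :=
    ae_restrict_of_ae_restrict_of_subset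
      (fun s (hs : s ∈ Set.Ioc 0 t) => (⟨hs.1.le, hs.2.trans ht.2⟩ : s ∈ Set.Icc (0 : ℝ) 1)) h
  rw [rlIntegral, rlIntegral, intervalIntegral.integral_of_le ht.1,
    intervalIntegral.integral_of_le ht.1]
  congr 1
  refine integral_congr_ae ?_
  filter_upwards [h'] with s hs
  simp only [rlIntegrand, hs]

theorem aestronglyMeasurable_rlIntegral
    (hα : AEMeasurable α (volume.restrict (Set.Ioc (0 : ℝ) 1))) (hf : StronglyMeasurable f) :
    AEStronglyMeasurable (rlIntegral α f) (volume.restrict (Set.Icc (0 : ℝ) 1)) := by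
  have hm := hα.measurable_mk
  set β := hα.mk α
  have hβ : ∀ᵐ t ∂(volume.restrict (Set.Icc (0 : ℝ) 1)), α t = β t := by
    rw [restrict_Icc_eq_restrict_Ioc]
    exact hα.ae_eq_mk
  -- Replacing `α` by the measurable `β` makes the kernel jointly measurable, so its integral in `s`
  -- is measurable in `t`.
  set F : ℝ × ℝ → 𝕜 := {q : ℝ × ℝ | 0 < q.2 ∧ q.2 ≤ q.1}.indicator
    (fun q => (q.1 - q.2) ^ (β q.1 - 1) • f q.2) with hF
  have hFm : StronglyMeasurable F := by
    refine StronglyMeasurable.indicator ?_ ((measurableSet_lt measurable_const measurable_snd).inter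
      (measurableSet_le measurable_snd measurable_fst))
    refine StronglyMeasurable.smul ?_ (hf.comp_measurable measurable_snd)
    exact ((measurable_fst.sub measurable_snd).pow
      ((hm.comp measurable_fst).sub measurable_const)).stronglyMeasurable
  have hI : StronglyMeasurable fun t => (1 / Real.Gamma (β t)) • ∫ s, F (t, s) :=
    (measurable_one_div_Gamma.comp hm).stronglyMeasurable.smul hFm.integral_prod_right'
  refine hI.aestronglyMeasurable.congr ?_
  filter_upwards [hβ, ae_mem_Ioc_zero_one] with t ht ht0
  rw [rlIntegral, ht, intervalIntegral.integral_of_le ht0.1.le,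
    ← integral_indicator measurableSet_Ioc]
  congr 1
  refine integral_congr_ae (ae_of_all _ fun s => ?_)
  simp only [hF, Set.indicator, Set.mem_ofPred_eq, Set.mem_Ioc, rlIntegrand, ht]

variable {p : ℝ≥0∞} [Fact (1 ≤ p)]

theorem eLpNorm_one_ne_top (f : LpUnit 𝕜 p) :
    eLpNorm f 1 (volume.restrict (Set.Icc (0 : ℝ) 1)) ≠ ∞ :=
  ((Lp.memLp f).mono_exponent Fact.out).eLpNorm_lt_top.ne

theorem ae_maximalFunction_unitENorm_lt_top (f : LpUnit 𝕜 p) :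
    ∀ᵐ t, maximalFunction (unitENorm f) t < ∞ :=
  ae_maximalFunction_lt_top (by rw [lintegral_unitENorm]; exact eLpNorm_one_ne_top f)

theorem ae_intervalIntegrable_rlIntegrand (hα0 : ∀ t ∈ Set.Ioc (0 : ℝ) 1, 0 < α t)
    (f : LpUnit 𝕜 p) : ∀ᵐ t ∂(volume.restrict (Set.Icc (0 : ℝ) 1)),
      IntervalIntegrable (rlIntegrand α f t) volume 0 t := by
  filter_upwards [ae_mem_Ioc_zero_one, ae_restrict_of_ae (ae_maximalFunction_unitENorm_lt_top f)]
    with t ht hM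
  exact intervalIntegrable_rlIntegrand (Lp.stronglyMeasurable f) ht (hα0 t ht) hM

/-- The Riemann–Liouville integral of variable order is a bounded operator on `L_p[0,1]`. -/
theorem exists_isRLOperator (hp : 1 < p)
    (hα : AEMeasurable α (volume.restrict (Set.Ioc (0 : ℝ) 1)))
    (hα0 : ∀ t ∈ Set.Ioc (0 : ℝ) 1, 0 < α t) :
    ∃ T : LpUnit 𝕜 p →L[𝕜] LpUnit 𝕜 p, IsRLOperator α T := by
  obtain ⟨K, hK, hKb⟩ := exists_eLpNorm_le_of_le_mul_maximalFunction 𝕜 hp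
  obtain ⟨C, hC, hCb⟩ := exists_inv_Gamma_mul_max_le
  have hmeas : ∀ f : LpUnit 𝕜 p,
      AEStronglyMeasurable (rlIntegral α f) (volume.restrict (Set.Icc (0 : ℝ) 1)) :=
    fun f => aestronglyMeasurable_rlIntegral hα (Lp.stronglyMeasurable f)
  have hbound : ∀ f : LpUnit 𝕜 p,
      eLpNorm (rlIntegral α f) p (volume.restrict (Set.Icc (0 : ℝ) 1)) ≤
        ENNReal.ofReal (2 * C * K) * eLpNorm f p (volume.restrict (Set.Icc (0 : ℝ) 1)) := by
    intro f
    rw [← eLpNorm_norm (rlIntegral α f)]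
    refine hKb f (Lp.stronglyMeasurable f) _ (hmeas f).norm.aemeasurable
      (fun t => norm_nonneg _) (2 * C) (by positivity) ?_
    filter_upwards [ae_mem_Ioc_zero_one] with t ht
    rw [ofReal_norm]
    refine (enorm_rlIntegral_le (Lp.stronglyMeasurable f) hCb ht (hα0 t ht)).trans ?_
    gcongr ENNReal.ofReal ?_ * _
    exact mul_le_of_le_one_right (by positivity)
      (Real.rpow_le_one ht.1.le ht.2 (hα0 t ht).le)
  have hmem : ∀ f : LpUnit 𝕜 p,
      MemLp (rlIntegral α f) p (volume.restrict (Set.Icc (0 : ℝ) 1)) := fun f =>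
    ⟨hmeas f, (hbound f).trans_lt (ENNReal.mul_lt_top ENNReal.ofReal_lt_top (Lp.eLpNorm_lt_top f))⟩
  let L : LpUnit 𝕜 p →ₗ[𝕜] LpUnit 𝕜 p :=
    { toFun := fun f => (hmem f).toLp
      map_add' := by
        intro f g
        rw [← MemLp.toLp_add, MemLp.toLp_eq_toLp_iff]
        filter_upwards [ae_mem_Ioc_zero_one, ae_intervalIntegrable_rlIntegrand hα0 f,
          ae_intervalIntegrable_rlIntegrand hα0 g] with t ht hf hg
        rw [rlIntegral_congr (Lp.coeFn_add f g) ⟨ht.1.le, ht.2⟩, Pi.add_apply]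
        simp only [rlIntegral, rlIntegrand_add]
        rw [intervalIntegral.integral_add hf hg, smul_add]
      map_smul' := by
        intro c f
        rw [RingHom.id_apply, ← MemLp.toLp_const_smul, MemLp.toLp_eq_toLp_iff]
        filter_upwards [ae_mem_Ioc_zero_one] with t ht
        rw [rlIntegral_congr (Lp.coeFn_smul c f) ⟨ht.1.le, ht.2⟩, Pi.smul_apply]
        simp only [rlIntegral, rlIntegrand_smul]
        rw [intervalIntegral.integral_smul, smul_comm] }
  refine ⟨L.mkContinuous (2 * C * K) fun f => ?_, fun f => ?_⟩
  · change ‖(hmem f).toLp‖ ≤ _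
    rw [Lp.norm_toLp, Lp.norm_def, ← ENNReal.toReal_ofReal (by positivity : 0 ≤ 2 * C * K),
      ← ENNReal.toReal_mul]
    exact ENNReal.toReal_mono
      (ENNReal.mul_ne_top ENNReal.ofReal_ne_top (Lp.eLpNorm_ne_top f)) (hbound f)
  · filter_upwards [ae_intervalIntegrable_rlIntegrand hα0 f, (hmem f).coeFn_toLp] with t h1 h2
    exact ⟨h1, h2⟩

end

/-! ### Compactness when `t ^ α(t)` tends to zero -/

/-- An operator that is dominated, up to arbitrarily small multiples of the norm, by finite rank
operators is compact. -/
theorem isCompactOperator_of_forall_exists_norm_le {𝕜 E F : Type*} [RCLike 𝕜]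
    [NormedAddCommGroup E] [NormedSpace 𝕜 E] [NormedAddCommGroup F] [NormedSpace 𝕜 F]
    [CompleteSpace F] (T : E →L[𝕜] F)
    (h : ∀ η : ℝ, 0 < η → ∃ (n : ℕ) (S : E →L[𝕜] (Fin n → 𝕜)),
      ∀ x, ‖T x‖ ≤ ‖S x‖ + η * ‖x‖) : IsCompactOperator T := by
  refine (isCompactOperator_iff_isCompact_closure_image_closedBall (T : E →ₗ[𝕜] F) one_pos).2 ?_
  refine TotallyBounded.isCompact_of_isClosed ?_ isClosed_closure
  refine TotallyBounded.closure (Metric.totallyBounded_iff.2 fun ε hε => ?_)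
  -- Points of the unit ball differ by at most 2 in norm, so the total error is at most `ε / 4 + 2 *
  -- (ε / 8) < ε`.
  obtain ⟨n, S, hS⟩ := h (ε / 8) (by positivity)
  have htb : TotallyBounded (S '' Metric.closedBall 0 1) := by
    have hb : Bornology.IsBounded (S '' Metric.closedBall 0 1) :=
      S.lipschitz.isBounded_image Metric.isBounded_closedBall
    exact hb.isCompact_closure.totallyBounded.subset subset_closure
  obtain ⟨N, hNsub, hN, hcov⟩ := Metric.finite_approx_of_totallyBounded htb (ε / 4) (by positivity)
  have hpre : ∀ z ∈ N, ∃ y ∈ Metric.closedBall (0 : E) 1, S y = z := fun z hz => hNsub hz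
  choose! y hy hSy using hpre
  refine ⟨(fun z => T (y z)) '' N, hN.image _, ?_⟩
  rintro _ ⟨x, hx, rfl⟩
  obtain ⟨z, hz, hxz⟩ := Set.mem_iUnion₂.1 (hcov ⟨x, hx, rfl⟩)
  refine Set.mem_iUnion₂.2 ⟨T (y z), ⟨z, hz, rfl⟩, ?_⟩
  have h1 := hS (x - y z)
  have h2 : ‖S (x - y z)‖ < ε / 4 := by
    rw [map_sub, hSy z hz, ← dist_eq_norm]
    exact hxz
  have h3 : ‖x - y z‖ ≤ 2 := by
    have e1 : ‖x‖ ≤ 1 := by simpa using hx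
    have e2 : ‖y z‖ ≤ 1 := by simpa using hy z hz
    linarith [norm_sub_le x (y z)]
  have h4 : dist (T x) (T (y z)) < ε := by
    rw [dist_eq_norm, ← map_sub]
    nlinarith
  exact h4

/-- The power `r₊ ^ (a - 1)`, made continuous by modifying it for `r < δ`. -/
noncomputable def cutPower (δ a r : ℝ) : ℝ := max r 0 * max r δ ^ (a - 2)

theorem continuous_cutPower {δ : ℝ} (hδ : 0 < δ) :
    Continuous fun q : ℝ × ℝ => cutPower δ q.1 q.2 := by
  unfold cutPower
  refine (continuous_snd.max continuous_const).mul ?_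
  exact (continuous_snd.max continuous_const).rpow (continuous_fst.sub continuous_const)
    fun q => Or.inl (lt_of_lt_of_le hδ (le_max_right _ _)).ne'

theorem cutPower_of_le {δ a r : ℝ} (hδ : 0 < δ) (h : δ ≤ r) : cutPower δ a r = r ^ (a - 1) := by
  have hr : 0 < r := hδ.trans_le h
  rw [cutPower, max_eq_left hr.le, max_eq_left h, show a - 1 = 1 + (a - 2) by ring,
    Real.rpow_add hr, Real.rpow_one]

theorem cutPower_of_nonpos {δ a r : ℝ} (h : r ≤ 0) : cutPower δ a r = 0 := by
  simp [cutPower, max_eq_right h]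

theorem cutPower_nonneg {δ a r : ℝ} (hδ : 0 < δ) : 0 ≤ cutPower δ a r :=
  mul_nonneg (le_max_right _ _) (Real.rpow_nonneg (hδ.le.trans (le_max_right _ _)) _)

theorem cutPower_le_of_lt {δ a r : ℝ} (hδ : 0 < δ) (h : r < δ) :
    cutPower δ a r ≤ δ ^ (a - 1) := by
  rw [cutPower, max_eq_right h.le, show a - 1 = 1 + (a - 2) by ring,
    Real.rpow_add hδ, Real.rpow_one]
  gcongr
  exact max_le h.le hδ.le

/-- The smoothed kernel is uniformly continuous on the compact set of `(a, t, s)`, so a finite net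
of parameters suffices. Order and endpoint vary independently, hence no regularity of `α` is needed.
-/
theorem exists_finset_cutPower_close {δ c A η : ℝ} (hδ : 0 < δ) (hc : 0 < c) (hη : 0 < η) :
    ∃ N : Finset (ℝ × ℝ), ∀ a ∈ Set.Icc c A, ∀ t ∈ Set.Icc (0 : ℝ) 1, ∃ q ∈ N,
      ∀ s ∈ Set.Icc (0 : ℝ) 1,
        |1 / Real.Gamma a * cutPower δ a (t - s) -
          1 / Real.Gamma q.1 * cutPower δ q.1 (q.2 - s)| ≤ η := by
  set X : Set (ℝ × ℝ) := Set.Icc c A ×ˢ Set.Icc (0 : ℝ) 1 with hX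
  have hXc : IsCompact X := isCompact_Icc.prod isCompact_Icc
  set Y : Set ((ℝ × ℝ) × ℝ) := X ×ˢ Set.Icc (0 : ℝ) 1 with hY
  have hYc : IsCompact Y := hXc.prod isCompact_Icc
  have hcont : ContinuousOn (fun q : (ℝ × ℝ) × ℝ =>
      1 / Real.Gamma q.1.1 * cutPower δ q.1.1 (q.1.2 - q.2)) Y := by
    refine ContinuousOn.mul ?_ ?_
    · intro q hq
      have hq0 : 0 < q.1.1 := hc.trans_le hq.1.1.1
      have hG : ContinuousAt Real.Gamma q.1.1 :=
        (Real.differentiableAt_Gamma fun m => by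
          have : (0 : ℝ) ≤ m := m.cast_nonneg
          linarith).continuousAt
      refine ContinuousAt.continuousWithinAt ?_
      refine continuousAt_const.div ?_ (Real.Gamma_pos_of_pos hq0).ne'
      exact ContinuousAt.comp (f := fun q : (ℝ × ℝ) × ℝ => q.1.1) hG (by fun_prop)
    · refine Continuous.continuousOn ?_
      exact (continuous_cutPower hδ).comp (by fun_prop : Continuous fun q : (ℝ × ℝ) × ℝ =>
        (q.1.1, q.1.2 - q.2))
  have huc := Metric.uniformContinuousOn_iff.1 (hYc.uniformContinuousOn_of_continuous hcont) η hη
  obtain ⟨ρ, hρ, H⟩ := huc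
  obtain ⟨N, hNX, hN, hcov⟩ := hXc.finite_cover_balls hρ
  refine ⟨hN.toFinset, fun a ha t ht => ?_⟩
  obtain ⟨q, hq, hqa⟩ := Set.mem_iUnion₂.1 (hcov (show (a, t) ∈ X from ⟨ha, ht⟩))
  refine ⟨q, hN.mem_toFinset.2 hq, fun s hs => ?_⟩
  have := H ((a, t), s) ⟨⟨ha, ht⟩, hs⟩ (q, s) ⟨hNX hq, hs⟩ (by
    rw [Prod.dist_eq, dist_self]
    exact max_lt hqa hρ)
  rw [Real.dist_eq] at this
  exact this.le

section

variable {𝕜 : Type*} [RCLike 𝕜] {p : ℝ≥0∞} [Fact (1 ≤ p)]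

theorem integrable_coeFn (f : LpUnit 𝕜 p) :
    Integrable f (volume.restrict (Set.Icc (0 : ℝ) 1)) :=
  (Lp.memLp f).integrable Fact.out

theorem integral_norm_coeFn_le (f : LpUnit 𝕜 p) :
    ∫ s in Set.Icc (0 : ℝ) 1, ‖f s‖ ≤ ‖f‖ := by
  rw [integral_norm_eq_lintegral_enorm (Lp.stronglyMeasurable f).aestronglyMeasurable, Lp.norm_def,
    ← eLpNorm_one_eq_lintegral_enorm]
  exact ENNReal.toReal_mono (Lp.eLpNorm_ne_top f)
    (eLpNorm_le_eLpNorm_of_exponent_le Fact.out (Lp.stronglyMeasurable f).aestronglyMeasurable)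

theorem integrable_smul_coeFn {h : ℝ → ℝ} (hh : Measurable h) {B : ℝ}
    (hB : ∀ s ∈ Set.Icc (0 : ℝ) 1, |h s| ≤ B) (f : LpUnit 𝕜 p) :
    Integrable (fun s => h s • f s) (volume.restrict (Set.Icc (0 : ℝ) 1)) := by
  refine ((integrable_coeFn f).norm.const_mul B).mono'
    (hh.stronglyMeasurable.smul (Lp.stronglyMeasurable f)).aestronglyMeasurable ?_
  filter_upwards [ae_restrict_mem measurableSet_Icc] with s hs
  rw [norm_smul, Real.norm_eq_abs]
  gcongr
  exact hB s hs

theorem norm_integral_smul_coeFn_le {h : ℝ → ℝ} {B : ℝ}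
    (hB : ∀ s ∈ Set.Icc (0 : ℝ) 1, |h s| ≤ B) (hB0 : 0 ≤ B) (f : LpUnit 𝕜 p) :
    ‖∫ s in Set.Icc (0 : ℝ) 1, h s • f s‖ ≤ B * ‖f‖ := by
  calc ‖∫ s in Set.Icc (0 : ℝ) 1, h s • f s‖
      ≤ ∫ s in Set.Icc (0 : ℝ) 1, B * ‖f s‖ := by
        refine norm_integral_le_of_norm_le ((integrable_coeFn f).norm.const_mul B) ?_
        filter_upwards [ae_restrict_mem measurableSet_Icc] with s hs
        rw [norm_smul, Real.norm_eq_abs]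
        gcongr
        exact hB s hs
    _ = B * ∫ s in Set.Icc (0 : ℝ) 1, ‖f s‖ := integral_const_mul _ _
    _ ≤ B * ‖f‖ := by
        gcongr
        exact integral_norm_coeFn_le f

theorem exists_bound_Icc_of_continuous {h : ℝ → ℝ} (hh : Continuous h) :
    ∃ B : ℝ, 0 ≤ B ∧ ∀ s ∈ Set.Icc (0 : ℝ) 1, |h s| ≤ B := by
  obtain ⟨B, hB⟩ := isCompact_Icc.exists_bound_of_continuousOn
    (hh.continuousOn (s := Set.Icc (0 : ℝ) 1))
  exact ⟨B, (abs_nonneg _).trans (hB 0 (by simp)), hB⟩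

/-- Integration against a continuous function is a continuous functional on `L_p[0,1]`. -/
theorem exists_continuousLinearMap_integral_smul {h : ℝ → ℝ} (hh : Continuous h) :
    ∃ l : LpUnit 𝕜 p →L[𝕜] 𝕜, ∀ f, l f = ∫ s in Set.Icc (0 : ℝ) 1, h s • f s := by
  obtain ⟨B, hB0, hB⟩ := exists_bound_Icc_of_continuous hh
  let L : LpUnit 𝕜 p →ₗ[𝕜] 𝕜 :=
    { toFun := fun f => ∫ s in Set.Icc (0 : ℝ) 1, h s • f s
      map_add' := by
        intro f g
        rw [← integral_add (integrable_smul_coeFn hh.measurable hB f)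
          (integrable_smul_coeFn hh.measurable hB g)]
        refine integral_congr_ae ?_
        filter_upwards [Lp.coeFn_add f g] with s hs
        rw [hs, Pi.add_apply, smul_add]
      map_smul' := by
        intro c f
        rw [RingHom.id_apply, ← integral_smul]
        refine integral_congr_ae ?_
        filter_upwards [Lp.coeFn_smul c f] with s hs
        rw [hs, Pi.smul_apply, smul_comm] }
  exact ⟨L.mkContinuous B fun f => norm_integral_smul_coeFn_le hB hB0 f, fun f => rfl⟩

variable {α : ℝ → ℝ}

theorem indicator_rpow_smul_eq (f : ℝ → 𝕜) (t : ℝ) :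
    (fun s => (Set.Ioo 0 t).indicator (fun s => (t - s) ^ (α t - 1)) s • f s) =
      (Set.Ioo 0 t).indicator (rlIntegrand α f t) := by
  ext s
  by_cases hs : s ∈ Set.Ioo 0 t
  · simp only [Set.indicator_of_mem hs, rlIntegrand]
  · simp only [Set.indicator_of_notMem hs, zero_smul]

theorem rlIntegral_eq_setIntegral_Icc (f : ℝ → 𝕜) {t : ℝ} (ht : t ∈ Set.Ioc (0 : ℝ) 1) :
    rlIntegral α f t = (1 / Real.Gamma (α t)) • ∫ s in Set.Icc (0 : ℝ) 1,
      (Set.Ioo 0 t).indicator (fun s => (t - s) ^ (α t - 1)) s • f s := by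
  rw [rlIntegral, intervalIntegral.integral_of_le ht.1.le, integral_Ioc_eq_integral_Ioo]
  congr 1
  have hsub : Set.Ioo 0 t ∩ Set.Icc (0 : ℝ) 1 = Set.Ioo 0 t :=
    Set.inter_eq_left.2 fun s hs => ⟨hs.1.le, hs.2.le.trans ht.2⟩
  rw [indicator_rpow_smul_eq, integral_indicator measurableSet_Ioo,
    Measure.restrict_restrict measurableSet_Ioo, hsub]

theorem integrable_indicator_smul {f : ℝ → 𝕜} {t : ℝ} (ht : t ∈ Set.Ioc (0 : ℝ) 1)
    (h : IntervalIntegrable (rlIntegrand α f t) volume 0 t) :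
    Integrable (fun s => (Set.Ioo 0 t).indicator (fun s => (t - s) ^ (α t - 1)) s • f s)
      (volume.restrict (Set.Icc (0 : ℝ) 1)) := by
  rw [indicator_rpow_smul_eq]
  have h1 := (intervalIntegrable_iff_integrableOn_Ioc_of_le ht.1.le).1 h
  exact ((h1.mono_set Set.Ioo_subset_Ioc_self).integrable_indicator measurableSet_Ioo).restrict

/-- The error made by smoothing the kernel near the diagonal. -/
theorem enorm_rlIntegral_sub_le (f : LpUnit 𝕜 p) {C : ℝ}
    (hC : ∀ a : ℝ, 0 < a → 1 / Real.Gamma a * max 1 (1 / a) ≤ C) {t δ : ℝ} (hδ : 0 < δ)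
    (ht : t ∈ Set.Ioc (0 : ℝ) 1) (ha : 0 < α t)
    (hint : IntervalIntegrable (rlIntegrand α f t) volume 0 t) :
    ‖rlIntegral α f t - ∫ s in Set.Icc (0 : ℝ) 1,
      (1 / Real.Gamma (α t) * cutPower δ (α t) (t - s)) • f s‖ₑ ≤
      ENNReal.ofReal (4 * C * δ ^ α t) * maximalFunction (unitENorm f) t := by
  set a := α t with ha'
  have hG := Real.Gamma_pos_of_pos ha
  have hcont : Continuous fun s : ℝ => cutPower δ a (t - s) :=
    (continuous_cutPower hδ).comp (by fun_prop : Continuous fun s : ℝ => (a, t - s))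
  obtain ⟨B, hB0, hB⟩ := exists_bound_Icc_of_continuous hcont
  have hgm : Measurable (unitENorm f) := measurable_unitENorm (Lp.stronglyMeasurable f)
  have hmk : Measurable fun s : ℝ => ENNReal.ofReal ((t - s) ^ (a - 1)) :=
    ((measurable_const.sub measurable_id).pow_const _).ennreal_ofReal
  have hkg : Measurable fun s : ℝ => ENNReal.ofReal ((t - s) ^ (a - 1)) * unitENorm f s :=
    hmk.mul hgm
  have hkg' : Measurable fun s : ℝ => ENNReal.ofReal ((t - s) ^ (a - 1)) * unitENorm f s +
      ENNReal.ofReal (δ ^ (a - 1)) * unitENorm f s := hkg.add (hgm.const_mul _)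
  simp only [mul_smul]
  rw [rlIntegral_eq_setIntegral_Icc _ ht, integral_smul, ← smul_sub, ← integral_sub
    (integrable_indicator_smul ht hint) (integrable_smul_coeFn hcont.measurable hB f), enorm_smul,
    Real.enorm_of_nonneg (by positivity)]
  -- The two kernels differ only for `t - δ < s < t`, apart from `s = 0`, which the open interval
  -- omits; the value `⊤` at this null point covers it.
  have hpt : ∀ s ∈ Set.Icc (0 : ℝ) 1,
      ‖(Set.Ioo 0 t).indicator (fun s => (t - s) ^ (a - 1)) s • f s -
        cutPower δ a (t - s) • f s‖ₑ ≤ (Set.Ioo (t - δ) t).indicator (fun s =>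
          ENNReal.ofReal ((t - s) ^ (a - 1)) * unitENorm f s +
            ENNReal.ofReal (δ ^ (a - 1)) * unitENorm f s) s + (({0} : Set ℝ).indicator ⊤) s := by
    intro s hs
    rcases eq_or_ne s 0 with rfl | hs0
    · simp
    rw [Set.indicator_of_notMem (by simpa using hs0) (⊤ : ℝ → ℝ≥0∞), add_zero]
    have hspos : 0 < s := lt_of_le_of_ne hs.1 hs0.symm
    by_cases h1 : s < t
    · have hm : s ∈ Set.Ioo 0 t := ⟨hspos, h1⟩
      rw [Set.indicator_of_mem hm]
      by_cases h2 : t - δ < s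
      · rw [Set.indicator_of_mem (show s ∈ Set.Ioo (t - δ) t from ⟨h2, h1⟩), unitENorm_of_mem hs]
        refine enorm_sub_le.trans ?_
        rw [enorm_smul, enorm_smul, Real.enorm_of_nonneg (Real.rpow_nonneg (by linarith) _),
          Real.enorm_of_nonneg (cutPower_nonneg hδ)]
        gcongr
        exact cutPower_le_of_lt hδ (by linarith)
      · rw [cutPower_of_le hδ (by linarith)]
        simp
    · rw [Set.indicator_of_notMem (fun h => h1 h.2), cutPower_of_nonpos (by linarith)]
      simp
  have hzero : ∫⁻ s in Set.Icc (0 : ℝ) 1, (({0} : Set ℝ).indicator (⊤ : ℝ → ℝ≥0∞)) s = 0 := by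
    rw [lintegral_indicator (measurableSet_singleton 0)]
    refine setLIntegral_measure_zero _ _ ?_
    exact le_antisymm ((Measure.restrict_le_self _).trans (by simp)) zero_le
  have hI : ∫⁻ s in Set.Icc (0 : ℝ) 1, ‖(Set.Ioo 0 t).indicator (fun s => (t - s) ^ (a - 1)) s • f s
      - cutPower δ a (t - s) • f s‖ₑ ≤ ENNReal.ofReal (2 * δ ^ a * max 1 (1 / a) + 2 * δ ^ a) *
        maximalFunction (unitENorm f) t := by
    calc _ ≤ ∫⁻ s in Set.Icc (0 : ℝ) 1, ((Set.Ioo (t - δ) t).indicator (fun s =>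
          ENNReal.ofReal ((t - s) ^ (a - 1)) * unitENorm f s +
            ENNReal.ofReal (δ ^ (a - 1)) * unitENorm f s) s + (({0} : Set ℝ).indicator ⊤) s) :=
          setLIntegral_mono' measurableSet_Icc hpt
      _ = ∫⁻ s in Set.Icc (0 : ℝ) 1, (Set.Ioo (t - δ) t).indicator (fun s =>
          ENNReal.ofReal ((t - s) ^ (a - 1)) * unitENorm f s +
            ENNReal.ofReal (δ ^ (a - 1)) * unitENorm f s) s := by
          rw [lintegral_add_left (hkg'.indicator measurableSet_Ioo), hzero, add_zero]
      _ ≤ ∫⁻ s, (Set.Ioo (t - δ) t).indicator (fun s =>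
          ENNReal.ofReal ((t - s) ^ (a - 1)) * unitENorm f s +
            ENNReal.ofReal (δ ^ (a - 1)) * unitENorm f s) s := setLIntegral_le_lintegral _ _
      _ = (∫⁻ s in Set.Ioo (t - δ) t, ENNReal.ofReal ((t - s) ^ (a - 1)) * unitENorm f s) +
            ENNReal.ofReal (δ ^ (a - 1)) * ∫⁻ s in Set.Ioo (t - δ) t, unitENorm f s := by
          rw [lintegral_indicator measurableSet_Ioo, lintegral_add_left hkg,
            lintegral_const_mul _ hgm]
      _ ≤ ENNReal.ofReal (2 * δ ^ a * max 1 (1 / a)) * maximalFunction (unitENorm f) t +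
            ENNReal.ofReal (δ ^ (a - 1)) *
              (ENNReal.ofReal (2 * δ) * maximalFunction (unitENorm f) t) := by
          gcongr
          · exact lintegral_Ioo_rpow_mul_le hgm ha hδ t
          · exact lintegral_Ioo_le_maximalFunction _ _ hδ
      _ = _ := by
          rw [← mul_assoc, ← ENNReal.ofReal_mul (by positivity), ← add_mul,
            ← ENNReal.ofReal_add (by positivity) (by positivity), Real.rpow_sub_one hδ.ne']
          congr 3
          field_simp
  calc _ ≤ ENNReal.ofReal (1 / Real.Gamma a) * (ENNReal.ofReal (2 * δ ^ a * max 1 (1 / a) +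
        2 * δ ^ a) * maximalFunction (unitENorm f) t) := by
        gcongr
        exact (enorm_integral_le_lintegral_enorm _).trans hI
    _ ≤ _ := by
        rw [← mul_assoc, ← ENNReal.ofReal_mul (by positivity)]
        gcongr ENNReal.ofReal ?_ * _
        have hδa : 0 < δ ^ a := Real.rpow_pos_of_pos hδ _
        -- Since the maximum is at least 1, it absorbs the contribution of the smoothed kernel,
        -- doubling 2 to 4.
        have h1 : 1 / Real.Gamma a * (2 * δ ^ a * max 1 (1 / a) + 2 * δ ^ a) ≤
            1 / Real.Gamma a * (4 * δ ^ a * max 1 (1 / a)) := by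
          gcongr
          nlinarith [le_max_left 1 (1 / a)]
        have h2 := mul_le_mul_of_nonneg_right (hC _ ha) (by positivity : 0 ≤ 4 * δ ^ a)
        linarith

/-- For order at least 1 the kernel is bounded by 1 on the unit interval, leaving only `1 / Γ` times
the `L_1` norm. -/
theorem norm_rlIntegral_le_of_one_le (f : LpUnit 𝕜 p) {t η : ℝ} (ht : t ∈ Set.Ioc (0 : ℝ) 1)
    (ha : 1 ≤ α t) (hη : 1 / Real.Gamma (α t) ≤ η) : ‖rlIntegral α f t‖ ≤ η * ‖f‖ := by
  have hG := Real.Gamma_pos_of_pos (zero_lt_one.trans_le ha)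
  rw [rlIntegral_eq_setIntegral_Icc _ ht, norm_smul, Real.norm_of_nonneg (by positivity)]
  have hb : ∀ s ∈ Set.Icc (0 : ℝ) 1,
      |(Set.Ioo 0 t).indicator (fun s => (t - s) ^ (α t - 1)) s| ≤ 1 := by
    intro s hs
    by_cases h : s ∈ Set.Ioo 0 t
    · rw [Set.indicator_of_mem h, abs_of_nonneg (Real.rpow_nonneg (by linarith [h.2]) _)]
      exact Real.rpow_le_one (by linarith [h.2]) (by linarith [h.1, ht.2]) (by linarith)
    · rw [Set.indicator_of_notMem h]
      simp
  have h1 := norm_integral_smul_coeFn_le hb zero_le_one f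
  rw [one_mul] at h1
  gcongr
  exact (by positivity : 0 ≤ 1 / Real.Gamma (α t)).trans hη

theorem isCompactOperator_of_tendsto_rpow (hp : 1 < p)
    (hpos : ∀ ε : ℝ, 0 < ε → ∃ c : ℝ, 0 < c ∧ ∀ t ∈ Set.Icc ε 1, c ≤ α t)
    {T : LpUnit 𝕜 p →L[𝕜] LpUnit 𝕜 p} (hT : IsRLOperator α T)
    (hlim : Tendsto (fun t : ℝ => t ^ α t) (𝓝[>] 0) (𝓝 0)) : IsCompactOperator T := by
  have hα0 : ∀ t ∈ Set.Ioc (0 : ℝ) 1, 0 < α t := fun t ht => by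
    obtain ⟨c, hc, h⟩ := hpos t ht.1
    exact hc.trans_le (h t ⟨le_rfl, ht.2⟩)
  obtain ⟨K, hK, hKb⟩ := exists_eLpNorm_le_of_le_mul_maximalFunction 𝕜 hp
  obtain ⟨C, hC, hCb⟩ := exists_inv_Gamma_mul_max_le
  refine isCompactOperator_of_forall_exists_norm_le T fun η' hη' => ?_
  -- The term `4 * C * η * K` will come from the maximal inequality, the other `η` from replacing a
  -- kernel by one of the finite net.
  obtain ⟨η, hη, hηη⟩ : ∃ η : ℝ, 0 < η ∧ 4 * C * η * K + η = η' :=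
    ⟨η' / (4 * C * K + 1), by positivity, by field_simp⟩
  obtain ⟨ε, hε, hsmall⟩ : ∃ ε : ℝ, 0 < ε ∧ ∀ t ∈ Set.Ioo 0 ε, t ^ α t < η :=
    mem_nhdsGT_iff_exists_Ioo_subset.1 (hlim.eventually_lt_const hη)
  obtain ⟨c, hc, hcα⟩ := hpos ε hε
  obtain ⟨A, hA1, hA⟩ := exists_inv_Gamma_le_of_le hη
  obtain ⟨δ, hδ, hδ1, hδc⟩ : ∃ δ : ℝ, 0 < δ ∧ δ ≤ 1 ∧ δ ^ c ≤ η := by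
    refine ⟨min 1 (η ^ c⁻¹), lt_min one_pos (by positivity), min_le_left _ _, ?_⟩
    calc (min 1 (η ^ c⁻¹)) ^ c ≤ (η ^ c⁻¹) ^ c := by
          gcongr
          exact min_le_right _ _
      _ = η := Real.rpow_inv_rpow hη.le hc.ne'
  obtain ⟨N, hN⟩ := exists_finset_cutPower_close (A := A) hδ hc hη
  have hcont : ∀ q : ℝ × ℝ,
      Continuous fun s : ℝ => 1 / Real.Gamma q.1 * cutPower δ q.1 (q.2 - s) := fun q =>
    continuous_const.mul ((continuous_cutPower hδ).comp
      (by fun_prop : Continuous fun s : ℝ => (q.1, q.2 - s)))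
  choose l hl using fun q : ℝ × ℝ =>
    exists_continuousLinearMap_integral_smul (𝕜 := 𝕜) (p := p) (hcont q)
  set S : LpUnit 𝕜 p →L[𝕜] (Fin N.card → 𝕜) :=
    ContinuousLinearMap.pi fun i => l (N.equivFin.symm i) with hS
  refine ⟨N.card, S, fun f => ?_⟩
  have hSq : ∀ q ∈ N, ‖l q f‖ ≤ ‖S f‖ := by
    intro q hq
    have := norm_le_pi_norm (S f) (N.equivFin ⟨q, hq⟩)
    simpa [hS] using this
  set b : ℝ := ‖S f‖ + η * ‖f‖ with hb
  have hb0 : 0 ≤ b := by positivity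
  -- Three regimes: `t < ε`, where `t ^ α t` is small; order at least `A`, where `1 / Γ` is small;
  -- and otherwise a smoothed kernel close to one in the net.
  have hpt : ∀ᵐ t ∂(volume.restrict (Set.Icc (0 : ℝ) 1)), ‖T f t‖ₑ ≤
      ENNReal.ofReal (4 * C * η) * maximalFunction (unitENorm f) t + ENNReal.ofReal b := by
    filter_upwards [hT f, ae_mem_Ioc_zero_one] with t hTt ht
    rw [hTt.2]
    have ha := hα0 t ht
    rcases lt_or_ge t ε with h1 | h1
    · refine (enorm_rlIntegral_le (Lp.stronglyMeasurable f) hCb ht ha).trans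
        (le_add_of_le_left ?_)
      gcongr ENNReal.ofReal ?_ * _
      have := (hsmall t ⟨ht.1, h1⟩).le
      have h0 : 0 < t ^ α t := Real.rpow_pos_of_pos ht.1 _
      nlinarith
    · have hca : c ≤ α t := hcα t ⟨h1, ht.2⟩
      rcases le_or_gt A (α t) with h2 | h2
      · refine le_add_of_le_right ?_
        rw [← ofReal_norm]
        refine ENNReal.ofReal_le_ofReal ?_
        refine (norm_rlIntegral_le_of_one_le f ht (hA1.trans h2) (hA _ h2)).trans ?_
        exact le_add_of_nonneg_left (norm_nonneg _)
      · obtain ⟨q, hq, hqs⟩ := hN (α t) ⟨hca, h2.le⟩ t ⟨ht.1.le, ht.2⟩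
        have hct := hcont (α t, t)
        obtain ⟨B, hB0, hB⟩ := exists_bound_Icc_of_continuous hct
        obtain ⟨B', hB0', hB'⟩ := exists_bound_Icc_of_continuous (hcont q)
        have h3 := enorm_rlIntegral_sub_le f hCb hδ ht ha hTt.1
        have h4 : ‖∫ s in Set.Icc (0 : ℝ) 1,
            (1 / Real.Gamma (α t) * cutPower δ (α t) (t - s)) • f s‖ ≤ b := by
          have h5 := norm_integral_smul_coeFn_le hqs hη.le f
          simp only [sub_smul] at h5
          rw [integral_sub (integrable_smul_coeFn hct.measurable hB f)
            (integrable_smul_coeFn (hcont q).measurable hB' f), ← hl q f] at h5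
          have h6 := hSq q hq
          have h7 := norm_le_norm_add_norm_sub' (∫ s in Set.Icc (0 : ℝ) 1,
            (1 / Real.Gamma (α t) * cutPower δ (α t) (t - s)) • f s) (l q f)
          linarith
        calc ‖rlIntegral α f t‖ₑ = ‖(rlIntegral α f t - ∫ s in Set.Icc (0 : ℝ) 1,
              (1 / Real.Gamma (α t) * cutPower δ (α t) (t - s)) • f s) +
              ∫ s in Set.Icc (0 : ℝ) 1,
              (1 / Real.Gamma (α t) * cutPower δ (α t) (t - s)) • f s‖ₑ := by
              rw [sub_add_cancel]
          _ ≤ _ := enorm_add_le _ _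
          _ ≤ _ := by
              refine add_le_add (h3.trans ?_) ?_
              · gcongr ENNReal.ofReal ?_ * _
                gcongr 4 * C * ?_
                exact (Real.rpow_le_rpow_of_exponent_ge hδ hδ1 hca).trans hδc
              · rw [← ofReal_norm]
                exact ENNReal.ofReal_le_ofReal h4
  -- The excess over `b` is dominated by the maximal function alone, so the strong type bound
  -- applies to the measurable `u`, with no measurability of `M f` required.
  set u : ℝ → ℝ := fun t => max (‖T f t‖ - b) 0 with hu
  have hum : StronglyMeasurable u := by
    refine Measurable.stronglyMeasurable ?_
    exact ((Lp.stronglyMeasurable (T f)).norm.measurable.sub measurable_const).max measurable_const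
  have hule := hKb f (Lp.stronglyMeasurable f) u hum.measurable.aemeasurable
    (fun t => le_max_right _ _) (4 * C * η) (by positivity) (by
      filter_upwards [hpt] with t ht
      rw [hu]
      simp only
      rw [ENNReal.ofReal_max, ENNReal.ofReal_zero, max_eq_left zero_le, ENNReal.ofReal_sub _ hb0,
        ofReal_norm]
      exact tsub_le_iff_right.2 ht)
  have h1 : eLpNorm (T f) p (volume.restrict (Set.Icc (0 : ℝ) 1)) ≤
      ENNReal.ofReal (4 * C * η * K) * eLpNorm f p (volume.restrict (Set.Icc (0 : ℝ) 1)) +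
        ENNReal.ofReal b := by
    calc eLpNorm (T f) p (volume.restrict (Set.Icc (0 : ℝ) 1))
        ≤ eLpNorm (u + fun _ => b) p (volume.restrict (Set.Icc (0 : ℝ) 1)) := by
          refine eLpNorm_mono_real fun t => ?_
          have := le_max_left (‖T f t‖ - b) 0
          simp only [Pi.add_apply, hu]
          linarith
      _ ≤ eLpNorm u p _ + eLpNorm (fun _ : ℝ => b) p _ :=
          eLpNorm_add_le hum.aestronglyMeasurable aestronglyMeasurable_const Fact.out
      _ ≤ _ := by
          gcongr
          rw [eLpNorm_const _ (zero_lt_one.trans hp).ne' (IsProbabilityMeasure.ne_zero _)]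
          simp [Real.enorm_of_nonneg hb0]
  have h2 := ENNReal.toReal_mono (ENNReal.add_ne_top.2 ⟨ENNReal.mul_ne_top ENNReal.ofReal_ne_top
    (Lp.eLpNorm_ne_top f), ENNReal.ofReal_ne_top⟩) h1
  rw [ENNReal.toReal_add (ENNReal.mul_ne_top ENNReal.ofReal_ne_top (Lp.eLpNorm_ne_top f))
    ENNReal.ofReal_ne_top, ENNReal.toReal_mul, ENNReal.toReal_ofReal (by positivity),
    ENNReal.toReal_ofReal hb0, ← Lp.norm_def, ← Lp.norm_def] at h2
  rw [← hηη]
  linarith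

end

/-! ### Non-compactness when `α(t) |log t|` is bounded -/

section

variable {𝕜 : Type*} [RCLike 𝕜] {p : ℝ≥0∞} [Fact (1 ≤ p)] {α : ℝ → ℝ}

theorem rlIntegral_indicator_const (c : 𝕜) (h : ℝ) {t : ℝ} (ht : 0 ≤ t) :
    rlIntegral α ((Set.Ioc 0 h).indicator fun _ => c) t =
      (1 / Real.Gamma (α t)) • ∫ s in Set.Ioc 0 (min t h), (t - s) ^ (α t - 1) • c := by
  rw [rlIntegral, intervalIntegral.integral_of_le ht]
  have : rlIntegrand α ((Set.Ioc 0 h).indicator fun _ => c) t =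
      (Set.Ioc 0 h).indicator fun s => (t - s) ^ (α t - 1) • c := by
    ext s
    by_cases hs : s ∈ Set.Ioc 0 h
    · simp only [rlIntegrand, Set.indicator_of_mem hs]
    · simp only [rlIntegrand, Set.indicator_of_notMem hs, smul_zero]
  rw [this, setIntegral_indicator measurableSet_Ioc, Set.Ioc_inter_Ioc, max_self]

theorem norm_rlIntegral_indicator_const_of_le (c : 𝕜) {h t : ℝ} (ht : 0 < t) (hth : t ≤ h)
    (ha : 0 < α t) :
    ‖rlIntegral α ((Set.Ioc 0 h).indicator fun _ => c) t‖ =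
      t ^ α t / Real.Gamma (α t + 1) * ‖c‖ := by
  have hG := Real.Gamma_pos_of_pos ha
  have hI : ∫ s in Set.Ioc 0 t, (t - s) ^ (α t - 1) = t ^ α t / α t := by
    rw [← intervalIntegral.integral_of_le ht.le,
      intervalIntegral.integral_comp_sub_left (fun r : ℝ => r ^ (α t - 1)), sub_self, sub_zero,
      integral_rpow (Or.inl (by linarith)), sub_add_cancel, Real.zero_rpow ha.ne', sub_zero]
  have htp : 0 < t ^ α t := Real.rpow_pos_of_pos ht _
  rw [rlIntegral_indicator_const c h ht.le, min_eq_left hth, integral_smul_const, hI, norm_smul,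
    norm_smul, Real.norm_of_nonneg (by positivity), Real.norm_of_nonneg (by positivity),
    Real.Gamma_add_one ha.ne', ← mul_assoc]
  congr 1
  field_simp

/-- Here `t - s` stays in `[t / 2, t]`; the sum of the two endpoint powers bounds the kernel
whatever the sign of `α t - 1`. -/
theorem norm_rlIntegral_indicator_const_le (c : 𝕜) {h t : ℝ} (hh : 0 < h) (hth : h ≤ t / 2)
    (ha : 0 < α t) :
    ‖rlIntegral α ((Set.Ioc 0 h).indicator fun _ => c) t‖ ≤
      1 / Real.Gamma (α t) * (t ^ (α t - 1) + (t / 2) ^ (α t - 1)) * (‖c‖ * h) := by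
  have hG := Real.Gamma_pos_of_pos ha
  have ht : 0 < t := by linarith
  have hI : ‖∫ s in Set.Ioc 0 h, (t - s) ^ (α t - 1) • c‖ ≤
      (t ^ (α t - 1) + (t / 2) ^ (α t - 1)) * ‖c‖ * volume.real (Set.Ioc 0 h) := by
    refine norm_setIntegral_le_of_norm_le_const (by simp) fun s hs => ?_
    have h1 : 0 < t - s := by linarith [hs.2]
    rw [norm_smul, Real.norm_of_nonneg (Real.rpow_nonneg h1.le _)]
    gcongr
    rcases le_total 1 (α t) with h2 | h2
    · have : (t - s) ^ (α t - 1) ≤ t ^ (α t - 1) :=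
        Real.rpow_le_rpow h1.le (by linarith [hs.1]) (by linarith)
      have h3 : 0 < (t / 2) ^ (α t - 1) := by positivity
      linarith
    · have : (t - s) ^ (α t - 1) ≤ (t / 2) ^ (α t - 1) :=
        Real.rpow_le_rpow_of_nonpos (by linarith) (by linarith [hs.2]) (by linarith)
      have h3 : 0 < t ^ (α t - 1) := by positivity
      linarith
  rw [Real.volume_real_Ioc_of_le hh.le, sub_zero] at hI
  rw [rlIntegral_indicator_const c h ht.le, min_eq_right (by linarith), norm_smul,
    Real.norm_of_nonneg (by positivity), mul_assoc]
  gcongr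
  linarith

/-- Near the origin, the operator does not contract normalized indicators. -/
theorem exists_rpow_div_Gamma_ge (hα0 : ∀ t ∈ Set.Ioc (0 : ℝ) 1, 0 < α t)
    (hbdd : IsBoundedUnder (· ≤ ·) (𝓝[>] 0) fun t : ℝ => α t * |Real.log t|) :
    ∃ m : ℝ, 0 < m ∧ ∃ ε : ℝ, 0 < ε ∧ ε ≤ 1 ∧ ∀ t ∈ Set.Ioo 0 ε,
      m ≤ t ^ α t / Real.Gamma (α t + 1) := by
  obtain ⟨M, hM⟩ := hbdd
  rw [eventually_map] at hM
  have hcont : ContinuousOn Real.Gamma (Set.Icc 1 2) := fun x hx =>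
    (Real.differentiableAt_Gamma fun m => by
      have : (0 : ℝ) ≤ m := m.cast_nonneg
      linarith [hx.1]).continuousAt.continuousWithinAt
  obtain ⟨G, hG⟩ := isCompact_Icc.exists_bound_of_continuousOn hcont
  have hGpos : 0 < G := by
    have := hG 1 (by simp)
    rw [Real.Gamma_one] at this
    simp only [norm_one] at this
    linarith
  have hev : ∀ᶠ t : ℝ in 𝓝[>] 0, t ∈ Set.Ioo (0 : ℝ) 1 ∧ α t * |Real.log t| ≤ M ∧
      Real.log t < -(max M 0) :=
    (eventually_mem_set.2 (Ioo_mem_nhdsGT one_pos)).and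
      (hM.and (Real.tendsto_log_nhdsGT_zero.eventually_lt_atBot _))
  obtain ⟨ε, hε, H⟩ := mem_nhdsGT_iff_exists_Ioo_subset.1 hev
  have hε0 : 0 < ε := hε
  refine ⟨Real.exp (-M) / G, by positivity, min ε 1, lt_min hε0 one_pos, min_le_right _ _,
    fun t ht => ?_⟩
  obtain ⟨ht1, ht2, ht3⟩ : t ∈ Set.Ioo (0 : ℝ) 1 ∧ α t * |Real.log t| ≤ M ∧
      Real.log t < -(max M 0) := H ⟨ht.1, ht.2.trans_le (min_le_left _ _)⟩
  have ha := hα0 t ⟨ht1.1, ht1.2.le⟩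
  have hlog : |Real.log t| = -Real.log t := abs_of_neg (Real.log_neg ht1.1 ht1.2)
  -- So close to zero that `|log t| > M`, an order above 1 would violate the bound `M`. Hence `Γ(α t
  -- + 1)` is evaluated on `[1, 2]`, where it is at most `G`.
  have ha1 : α t ≤ 1 := by
    by_contra hcon
    push Not at hcon
    have h1 : max M 0 < |Real.log t| := by rw [hlog]; linarith
    have h2 : |Real.log t| ≤ α t * |Real.log t| :=
      le_mul_of_one_le_left (abs_nonneg _) hcon.le
    linarith [le_max_left M 0]
  have hΓ := hG (α t + 1) ⟨by linarith, by linarith⟩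
  have hΓ0 := Real.Gamma_pos_of_pos (show 0 < α t + 1 by linarith)
  rw [Real.norm_of_nonneg hΓ0.le] at hΓ
  have hexp : Real.exp (-M) ≤ t ^ α t := by
    rw [Real.rpow_def_of_pos ht1.1]
    refine Real.exp_le_exp.2 ?_
    rw [hlog] at ht2
    linarith
  exact div_le_div₀ (Real.rpow_nonneg ht1.1.le _) hexp hΓ0 hΓ

theorem not_isCompactOperator_of_isBoundedUnder (hp : 1 < p)
    (hα0 : ∀ t ∈ Set.Ioc (0 : ℝ) 1, 0 < α t)
    {T : LpUnit 𝕜 p →L[𝕜] LpUnit 𝕜 p} (hT : IsRLOperator α T)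
    (hbdd : IsBoundedUnder (· ≤ ·) (𝓝[>] 0) fun t : ℝ => α t * |Real.log t|) :
    ¬ IsCompactOperator T := by
  intro hcomp
  obtain ⟨m, hm, ε, hε, hε1, hlow⟩ := exists_rpow_div_Gamma_ge hα0 hbdd
  -- For `p = ∞` the conventions `toReal ∞ = 0` and `1 / 0 = 0` give the right exponent `e = 0`.
  set e : ℝ := 1 / p.toReal with he
  have he1 : e < 1 := by
    rcases eq_or_ne p ∞ with rfl | hp'
    · simp [he]
    · have : 1 < p.toReal := by
        have := (ENNReal.toReal_lt_toReal ENNReal.one_ne_top hp').2 hp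
        simpa using this
      rw [he]
      exact (div_lt_one (by linarith)).2 this
  set h : ℕ → ℝ := fun n => ε / (n + 2) with hh
  have hh0 : ∀ n, 0 < h n := fun n => by positivity
  have hhε : ∀ n, h n < ε := fun n => by
    have : (0 : ℝ) ≤ n := n.cast_nonneg
    exact div_lt_self hε (by linarith)
  have hhlim : Tendsto h atTop (𝓝 0) :=
    Tendsto.const_div_atTop (tendsto_natCast_atTop_atTop.atTop_add tendsto_const_nhds) _
  set c : ℕ → 𝕜 := fun n => ((h n ^ (-e) : ℝ) : 𝕜) with hc
  have hcn : ∀ n, ‖c n‖ = h n ^ (-e) := fun n => by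
    simp only [hc]
    rw [RCLike.norm_ofReal, abs_of_nonneg (Real.rpow_nonneg (hh0 n).le _)]
  have hμ : ∀ n, (volume.restrict (Set.Icc (0 : ℝ) 1)) (Set.Ioc 0 (h n)) =
      ENNReal.ofReal (h n) := by
    intro n
    have hsub : Set.Ioc 0 (h n) ⊆ Set.Icc (0 : ℝ) 1 := fun s hs =>
      ⟨hs.1.le, hs.2.trans ((hhε n).le.trans hε1)⟩
    rw [Measure.restrict_apply measurableSet_Ioc, Set.inter_eq_left.2 hsub, Real.volume_Ioc,
      sub_zero]
  set F : ℕ → LpUnit 𝕜 p := fun n => indicatorConstLp p (measurableSet_Ioc (a := 0) (b := h n))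
    (by rw [hμ]; exact ENNReal.ofReal_ne_top) (c n) with hF
  have hFnorm : ∀ n, ‖F n‖ = 1 := by
    intro n
    rw [hF]
    simp only
    rw [norm_indicatorConstLp' (zero_lt_one.trans hp).ne'
      (by rw [hμ]; simpa using hh0 n), hcn, measureReal_def, hμ, ENNReal.toReal_ofReal (hh0 n).le,
      ← he, ← Real.rpow_add (hh0 n)]
    simp
  have hFcoe : ∀ n, F n =ᵐ[volume.restrict (Set.Icc (0 : ℝ) 1)]
      (Set.Ioc 0 (h n)).indicator fun _ => c n := fun n => indicatorConstLp_coeFn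
  have hTF : ∀ n, ∀ᵐ t ∂(volume.restrict (Set.Icc (0 : ℝ) 1)),
      T (F n) t = rlIntegral α ((Set.Ioc 0 (h n)).indicator fun _ => c n) t := by
    intro n
    filter_upwards [hT (F n), ae_restrict_mem measurableSet_Icc] with t ht ht1
    rw [ht.2, rlIntegral_congr (hFcoe n) ht1]
  have hlower : ∀ n, m ≤ ‖T (F n)‖ := by
    intro n
    have h1 : ‖F n‖ ≤ m⁻¹ * ‖T (F n)‖ := by
      refine Lp.norm_le_mul_norm_of_ae_le_mul ?_
      filter_upwards [hTF n, hFcoe n, ae_mem_Ioc_zero_one] with t ht1 ht2 ht3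
      rw [ht1, ht2]
      by_cases hs : t ∈ Set.Ioc 0 (h n)
      · rw [norm_rlIntegral_indicator_const_of_le _ ht3.1 hs.2 (hα0 t ht3),
          Set.indicator_of_mem hs, ← mul_assoc]
        have h2 := hlow t ⟨ht3.1, hs.2.trans_lt (hhε n)⟩
        refine le_mul_of_one_le_left (norm_nonneg _) ?_
        rwa [le_inv_mul_iff₀ hm, mul_one]
      · rw [Set.indicator_of_notMem hs, norm_zero]
        positivity
    rw [hFnorm n, le_inv_mul_iff₀ hm, mul_one] at h1
    exact h1
  -- Once `h n ≤ t / 2`, the value is at most a constant depending on `t` times the `L_1` norm `h n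
  -- ^ (1 - e)` of the indicator, which vanishes in the limit because `p > 1`.
  have hpt : ∀ t ∈ Set.Ioc (0 : ℝ) 1, Tendsto (fun n =>
      rlIntegral α ((Set.Ioc 0 (h n)).indicator fun _ => c n) t) atTop (𝓝 0) := by
    intro t ht
    have hlim : Tendsto (fun n => ‖c n‖ * h n) atTop (𝓝 0) := by
      have h1 : (fun n => ‖c n‖ * h n) = fun n => h n ^ (1 - e) := by
        ext n
        rw [hcn, ← Real.rpow_add_one (hh0 n).ne']
        congr 1; ring
      rw [h1]
      have h2 := hhlim.rpow_const (p := 1 - e) (Or.inr (by linarith))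
      rwa [Real.zero_rpow (by linarith)] at h2
    have hlim' := hlim.const_mul
      (1 / Real.Gamma (α t) * (t ^ (α t - 1) + (t / 2) ^ (α t - 1)))
    rw [mul_zero] at hlim'
    refine squeeze_zero_norm' ?_ hlim'
    filter_upwards [hhlim.eventually_le_const (half_pos ht.1)] with n hn
    exact norm_rlIntegral_indicator_const_le _ (hh0 n) hn (hα0 t ht)
  have hK := hcomp.isCompact_closure_image_closedBall
    (f := (T : LpUnit 𝕜 p →ₗ[𝕜] LpUnit 𝕜 p)) 1
  obtain ⟨g, -, φ, hφ, hg⟩ := hK.tendsto_subseq (x := fun n => T (F n)) fun n =>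
    subset_closure ⟨F n, by simp [hFnorm n], rfl⟩
  obtain ⟨ns, hns, hae⟩ := (tendstoInMeasure_of_tendsto_Lp hg).exists_seq_tendsto_ae
  -- Norm convergence gives almost everywhere convergence along a further subsequence, which
  -- identifies the limit with the pointwise limit zero, against the lower bound `m`.
  have hg0 : g = 0 := by
    rw [Lp.eq_zero_iff_ae_eq_zero]
    filter_upwards [hae, ae_all_iff.2 hTF, ae_mem_Ioc_zero_one] with t h1 h2 h3
    refine tendsto_nhds_unique h1 ?_
    simp only [Function.comp_apply, h2]
    exact (hpt t h3).comp (hφ.tendsto_atTop.comp hns.tendsto_atTop)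
  rw [hg0] at hg
  have h0 := ge_of_tendsto' hg.norm fun n => hlower (φ n)
  rw [norm_zero] at h0
  linarith

end

/-! ### Equivalent forms of the hypotheses and conclusion -/

theorem eventually_rpow_eq_exp (α : ℝ → ℝ) :
    ∀ᶠ t : ℝ in 𝓝[>] 0, t ^ α t = Real.exp (-(α t * |Real.log t|)) := by
  filter_upwards [Ioo_mem_nhdsGT (one_pos : (0 : ℝ) < 1)] with t ht
  rw [Real.rpow_def_of_pos ht.1, abs_of_neg (Real.log_neg ht.1 ht.2)]
  congr 1; ring

theorem tendsto_rpow_iff_tendsto_mul_abs_log (α : ℝ → ℝ) :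
    Tendsto (fun t : ℝ => t ^ α t) (𝓝[>] 0) (𝓝 0) ↔
      Tendsto (fun t : ℝ => α t * |Real.log t|) (𝓝[>] 0) atTop := by
  rw [tendsto_congr' (eventually_rpow_eq_exp α), Real.tendsto_exp_comp_nhds_zero,
    tendsto_neg_atBot_iff]

theorem liminf_rpow_pos_iff_isBoundedUnder {α : ℝ → ℝ}
    (hα0 : ∀ t ∈ Set.Ioc (0 : ℝ) 1, 0 < α t) :
    0 < liminf (fun t : ℝ => t ^ α t) (𝓝[>] 0) ↔
      IsBoundedUnder (· ≤ ·) (𝓝[>] 0) (fun t : ℝ => α t * |Real.log t|) := by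
  have hpos : ∀ᶠ t : ℝ in 𝓝[>] 0, 0 ≤ α t * |Real.log t| := by
    filter_upwards [Ioo_mem_nhdsGT (one_pos : (0 : ℝ) < 1)] with t ht
    exact mul_nonneg (hα0 t ⟨ht.1, ht.2.le⟩).le (abs_nonneg _)
  rw [liminf_congr (eventually_rpow_eq_exp α)]
  constructor
  · intro h
    obtain ⟨c, hc, hcl⟩ := exists_between h
    have hb : IsBoundedUnder (· ≥ ·) (𝓝[>] 0)
        (fun t : ℝ => Real.exp (-(α t * |Real.log t|))) :=
      isBoundedUnder_of ⟨0, fun t => (Real.exp_pos _).le⟩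
    refine ⟨-Real.log c, ?_⟩
    rw [eventually_map]
    filter_upwards [eventually_lt_of_lt_liminf hcl hb] with t ht
    have := (Real.log_lt_iff_lt_exp hc).2 ht
    linarith
  · rintro ⟨M, hM⟩
    rw [eventually_map] at hM
    -- A real `liminf` is a supremum of eventual lower bounds, meaningful only if these are bounded
    -- above; the bound 1 holds since `α > 0`.
    have hcob : IsCoboundedUnder (· ≥ ·) (𝓝[>] 0)
        (fun t : ℝ => Real.exp (-(α t * |Real.log t|))) := by
      refine IsBoundedUnder.isCoboundedUnder_ge ⟨1, ?_⟩
      rw [eventually_map]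
      filter_upwards [hpos] with t ht
      exact Real.exp_le_one_iff.2 (by linarith)
    refine (Real.exp_pos (-M)).trans_le (le_liminf_of_le hcob ?_)
    filter_upwards [hM] with t ht
    exact Real.exp_le_exp.2 (by linarith)

theorem theorem5p3 {𝕜 : Type*} [RCLike 𝕜] (p : ℝ≥0∞) [Fact (1 ≤ p)] (hp : 1 < p)
    (α : ℝ → ℝ) (hα : AEMeasurable α (volume.restrict (Set.Ioc (0 : ℝ) 1)))
    (hpos : ∀ ε : ℝ, 0 < ε → ∃ c : ℝ, 0 < c ∧ ∀ t ∈ Set.Icc ε 1, c ≤ α t) :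
    (∃ T : LpUnit 𝕜 p →L[𝕜] LpUnit 𝕜 p, IsRLOperator α T ∧
      (Tendsto (fun t : ℝ => t ^ α t) (𝓝[>] 0) (𝓝 0) → IsCompactOperator T) ∧
      (0 < liminf (fun t : ℝ => t ^ α t) (𝓝[>] 0) → ¬ IsCompactOperator T) ∧
      (Tendsto (fun t : ℝ => α t * |Real.log t|) (𝓝[>] 0) atTop → IsCompactOperator T) ∧
      (IsBoundedUnder (· ≤ ·) (𝓝[>] 0) (fun t : ℝ => α t * |Real.log t|) →
        ¬ IsCompactOperator T)) ∧
    (Tendsto (fun t : ℝ => t ^ α t) (𝓝[>] 0) (𝓝 0) ↔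
      Tendsto (fun t : ℝ => α t * |Real.log t|) (𝓝[>] 0) atTop) ∧
    (0 < liminf (fun t : ℝ => t ^ α t) (𝓝[>] 0) ↔
      IsBoundedUnder (· ≤ ·) (𝓝[>] 0) (fun t : ℝ => α t * |Real.log t|)) := by
  have hα0 : ∀ t ∈ Set.Ioc (0 : ℝ) 1, 0 < α t := fun t ht => by
    obtain ⟨c, hc, h⟩ := hpos t ht.1
    exact hc.trans_le (h t ⟨le_rfl, ht.2⟩)
  have h1 := tendsto_rpow_iff_tendsto_mul_abs_log α
  have h2 := liminf_rpow_pos_iff_isBoundedUnder hα0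
  obtain ⟨T, hT⟩ := exists_isRLOperator (𝕜 := 𝕜) hp hα hα0
  exact ⟨⟨T, hT, fun h => isCompactOperator_of_tendsto_rpow hp hpos hT h,
    fun h => not_isCompactOperator_of_isBoundedUnder hp hα0 hT (h2.1 h),
    fun h => isCompactOperator_of_tendsto_rpow hp hpos hT (h1.2 h),
    fun h => not_isCompactOperator_of_isBoundedUnder hp hα0 hT h⟩, h1, h2⟩
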